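/- Let $n,N\ge 0$ and $m\ge 1$ be integers, let $A_1,\dots,A_N\in\mathbb R^{n\times n}$ be Metzler matrices (real matrices with nonnegative off-diagonal entries), and let $Q=[q_{ij}]\in\mathbb R^{N\times N}$ satisfy $q_{ij}\ge 0$ for $i\ne j$ and $q_{ii}=-\sum_{j\ne i}q_{ij}$. Fix a probability space $(\Omega,\mathcal M,P)$. For each $r_0\in\{1,\dots,N\}$ let $r=\{r(t)\}_{t\ge 0}$ be a homogeneous continuous-time Markov process on $\Omega$ with values in $\{1,\dots,N\}$, with $r(0)=r_0$ almost surely, whose paths are almost surely right-continuous with left limits (that is, piecewise constant with finitely many jumps in every bounded interval), and with infinitesimal generator $Q$: as $h\downarrow 0$, $$P(r(t+h)=j\mid r(t)=i)=\begin{cases} q_{ij}h+o(h), & i\ne j,\\ 1+q_{ii}h+o(h), & i=j,\end{cases}$$ for all $t\ge 0$ and all $i,j$ with $P(r(t)=i)>0$. For each $r_0$ and each constant vector $x_0\in\mathbb R^n$ let $x(t)$, $t\ge 0$, be the almost surely unique continuous solution of $$\Sigma:\quad \frac{dx}{dt}=A_{r(t)}x(t),\qquad x(0)=x_0,\qquad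 r(0)=r_0$$ (at the jump times of $r$ the derivative is the right derivative). The positive Markovian jump linear system $\Sigma$ is called exponentially $m$-th mean stable if there exist $C>0$ and $\beta>0$ such that, for all $x_0\in\mathbb R^n$, $r_0\in\{1,\dots,N\}$ and $t\ge 0$, the expectation $E[\|x(t)\|^m]$ exists and $$E[\|x(t)\|^m]\le Ce^{-\beta t}\|x_0\|^m,$$ where $\|\cdot\|$ is the Euclidean norm. Put $n_m=\binom{n+m-1}{m}$. For $x\in\mathbb R^n$ let $x^{[m]}\in\mathbb R^{n_m}$ be the vector of all the monomials of degree $m$ in $x_1,\dots,x_n$, the monomial $x_1^{a_1}\cdots x_n^{a_n}$ having the coefficient $\sqrt{m!/(a_1!\cdots a_n!)}$ (so that $\|x^{[m]}\|=\|x\|^m$). For $A\in\mathbb R^{n\times n}$ let $A_{[m]}\in\mathbb R^{n_m\times n_m}$ be the unique matrix such that $\frac{dx}{dt}=Ax$ implies $\frac{dx^{[m]}}{dt}=A_{[m]}x^{[m]}$ for every differentiable $x:\mathbb R\to\mathbb R^n$. Then $\Sigma$ is exponentially $m$-th mean stable if and only if the matrix $$\mathcal T_m=Q^\top\otimes I_{n_m}+\operatorname{diag}\big((A_1)_{[m]},\dots,(A_N)_{[m]}\big)\in\mathbb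 R^{(n_mN)\times(n_mN)}$$ is Hurwitz stable, i.e. all its complex eigenvalues have negative real part. -/

import Mathlib

open MeasureTheory ProbabilityTheory Filter Topology Set Asymptotics
open scoped Matrix Kronecker

noncomputable section

/-! ### Matrices -/

/-- A real square matrix is Metzler if its off-diagonal entries are nonnegative. -/
def IsMetzler {n : ℕ} (A : Matrix (Fin n) (Fin n) ℝ) : Prop :=
  ∀ i j, i ≠ j → 0 ≤ A i j

/-- A real square matrix is Hurwitz stable if all its (complex) eigenvalues have negative
real part. -/
def IsHurwitz {ι : Type*} [Fintype ι] [DecidableEq ι] (T : Matrix ι ι ℝ) : Prop :=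
  ∀ μ : ℂ, Module.End.HasEigenvalue (Matrix.toLin' (T.map (algebraMap ℝ ℂ))) μ → μ.re < 0

/-- `Q` is the infinitesimal generator of a Markov process on the states `Fin N`: the off-diagonal
entries are nonnegative and `q_ii = -∑_{j ≠ i} q_ij`. -/
structure IsGenerator {N : ℕ} (Q : Matrix (Fin N) (Fin N) ℝ) : Prop where
  nonneg : ∀ i j, i ≠ j → 0 ≤ Q i j
  diag : ∀ i, Q i i = -∑ j ∈ Finset.univ.erase i, Q i j

/-! ### The vector of weighted monomials of degree `m`

The monomials of degree `m` in `x_1, …, x_n` are indexed by the multisets of `m` elements of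
`Fin n`; there are `(n + m - 1).choose m` of them. -/

/-- The vector `x^[m]`: the monomial of exponent `s` has the coefficient
`√(m! / ∏ i, (s.count i)!)`, so that the Euclidean norms satisfy `‖x^[m]‖ = ‖x‖ ^ m`. -/
def powerVec {n : ℕ} (m : ℕ) (x : Fin n → ℝ) : Sym (Fin n) m → ℝ :=
  fun s => √((s : Multiset (Fin n)).countPerms : ℝ) * ((s : Multiset (Fin n)).map x).prod

/-- The matrix `A_[m]`, the unique one such that `dx/dt = A x` implies
`d(x^[m])/dt = A_[m] x^[m]` (see `hasDerivAt_powerVec` and `lowerPower_unique` below).  By the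
Leibniz rule, `d(x^s)/dt = ∑ k l, (s.count k) * A k l * x^(s - k + l)`. -/
def lowerPower {n : ℕ} (m : ℕ) (A : Matrix (Fin n) (Fin n) ℝ) :
    Matrix (Sym (Fin n) m) (Sym (Fin n) m) ℝ :=
  Matrix.of fun s s' =>
    √((s : Multiset (Fin n)).countPerms : ℝ) / √((s' : Multiset (Fin n)).countPerms : ℝ) *
      ∑ k, ∑ l, if l ::ₘ (s : Multiset (Fin n)).erase k = (s' : Multiset (Fin n)) then
        ((s : Multiset (Fin n)).count k : ℝ) * A k l else 0

/-- The matrix `Qᵀ ⊗ I + diag((A_1)_[m], …, (A_N)_[m])`, with rows and columns indexed by pairs of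
a state and a monomial. -/
def meanMatrix {n N : ℕ} (m : ℕ) (A : Fin N → Matrix (Fin n) (Fin n) ℝ)
    (Q : Matrix (Fin N) (Fin N) ℝ) :
    Matrix (Fin N × Sym (Fin n) m) (Fin N × Sym (Fin n) m) ℝ :=
  Qᵀ ⊗ₖ (1 : Matrix (Sym (Fin n) m) (Sym (Fin n) m) ℝ) +
    (Matrix.blockDiagonal fun i => lowerPower m (A i)).submatrix Prod.swap Prod.swap

/-! ### Jump linear systems -/

section JumpSystems

variable {Ω : Type*} [MeasurableSpace Ω]

/-- The σ-algebra generated by the process `r` on the time interval `[0, s]`. -/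
abbrev history {N : ℕ} (r : ℝ → Ω → Fin N) (s : ℝ) : MeasurableSpace Ω :=
  ⨆ u ∈ Icc (0 : ℝ) s, MeasurableSpace.comap (r u) ⊤

/-- `r` (on the times `t ≥ 0`) is a homogeneous continuous-time Markov process on `Fin N` with
generator `Q` and, almost surely, right-continuous paths with left limits.  Conditional
probabilities are only considered given events of nonzero probability. -/
structure IsMarkovProcess {N : ℕ} (P : Measure Ω) (Q : Matrix (Fin N) (Fin N) ℝ)
    (r : ℝ → Ω → Fin N) : Prop where
  measurable : ∀ t, 0 ≤ t → Measurable (r t)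
  markov : ∀ s h, 0 ≤ s → 0 ≤ h → ∀ i j, ∀ B, MeasurableSet[history r s] B →
    P (r s ⁻¹' {i} ∩ B) ≠ 0 →
    P[r (s + h) ⁻¹' {j} | r s ⁻¹' {i} ∩ B] = P[r (s + h) ⁻¹' {j} | r s ⁻¹' {i}]
  homogeneous : ∀ s s' h, 0 ≤ s → 0 ≤ s' → 0 ≤ h → ∀ i j,
    P (r s ⁻¹' {i}) ≠ 0 → P (r s' ⁻¹' {i}) ≠ 0 →
    P[r (s + h) ⁻¹' {j} | r s ⁻¹' {i}] = P[r (s' + h) ⁻¹' {j} | r s' ⁻¹' {i}]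
  rate : ∀ t, 0 ≤ t → ∀ i j, P (r t ⁻¹' {i}) ≠ 0 →
    (fun h : ℝ => (P[r (t + h) ⁻¹' {j} | r t ⁻¹' {i}]).toReal -
      ((if i = j then 1 else 0) + Q i j * h)) =o[𝓝[>] 0] fun h : ℝ => h
  cadlag : ∀ᵐ ω ∂P, (∀ t, 0 ≤ t → ∀ᶠ u in 𝓝[>] t, r u ω = r t ω) ∧
    (∀ t, 0 < t → ∃ j, ∀ᶠ u in 𝓝[<] t, r u ω = j)

/-- `y` solves `dy/dt = A_{ρ(t)} y` on `[0, ∞)` with `y(0) = v`: it is continuous, and satisfies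
the equation with the right derivative (at the jump times of the right-continuous path `ρ`
there is no two-sided derivative in general). -/
structure IsSolution {n N : ℕ} (A : Fin N → Matrix (Fin n) (Fin n) ℝ) (ρ : ℝ → Fin N)
    (v : Fin n → ℝ) (y : ℝ → Fin n → ℝ) : Prop where
  continuousOn : ContinuousOn y (Ici 0)
  initial : y 0 = v
  deriv : ∀ t, 0 ≤ t → HasDerivWithinAt y (A (ρ t) *ᵥ y t) (Ici t) t

/-- Exponential `m`-th mean stability of the trajectories `x r₀ x₀` started at the mode `r₀` and
the vector `x₀`, with the Euclidean norm: `E[‖x(t)‖ ^ m] ≤ C e^(-β t) ‖x₀‖ ^ m`, with `C` and `β`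
not depending on `r₀`, `x₀` and `t`.  Existence of the expectation is part of the definition. -/
def ExponentiallyMeanStable {n N : ℕ} (P : Measure Ω) (m : ℕ)
    (x : Fin N → (Fin n → ℝ) → ℝ → Ω → (Fin n → ℝ)) : Prop :=
  ∃ C β : ℝ, 0 < C ∧ 0 < β ∧ ∀ (r₀ : Fin N) (x₀ : Fin n → ℝ) (t : ℝ), 0 ≤ t →
    Integrable (fun ω => ‖WithLp.toLp 2 (x r₀ x₀ t ω)‖ ^ m) P ∧
    ∫ ω, ‖WithLp.toLp 2 (x r₀ x₀ t ω)‖ ^ m ∂P ≤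
      C * Real.exp (-β * t) * ‖WithLp.toLp 2 x₀‖ ^ m

end JumpSystems

/-! ### The characteristic properties of `x^[m]` and `A_[m]` -/

theorem countPerms_pos {n : ℕ} (s : Multiset (Fin n)) : 0 < s.countPerms := by
  unfold Multiset.countPerms
  rw [Finsupp.multinomial_eq]
  exact Nat.multinomial_pos _ _

/-- `‖x^[m]‖ = ‖x‖ ^ m` for the Euclidean norms. -/
theorem norm_powerVec {n : ℕ} (m : ℕ) (x : Fin n → ℝ) :
    ‖WithLp.toLp 2 (powerVec m x)‖ = ‖WithLp.toLp 2 x‖ ^ m := by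
  rw [← sq_eq_sq₀ (norm_nonneg _) (by positivity), ← pow_mul, mul_comm m 2, pow_mul,
    EuclideanSpace.real_norm_sq_eq, EuclideanSpace.real_norm_sq_eq, Finset.sum_pow]
  simp only [Finset.sym_univ]
  refine Finset.sum_congr rfl fun s _ => ?_
  simp only [powerVec, mul_pow, Multiset.prod_map_pow]
  rw [Real.sq_sqrt (by positivity)]
  rfl

/-- `dx/dt = A x` implies `d(x^[m])/dt = A_[m] x^[m]`. -/
theorem hasDerivAt_powerVec {n : ℕ} (m : ℕ) (A : Matrix (Fin n) (Fin n) ℝ)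
    (x : ℝ → Fin n → ℝ) (t : ℝ) (hx : HasDerivAt x (A *ᵥ x t) t) :
    HasDerivAt (fun u => powerVec m (x u)) (lowerPower m A *ᵥ powerVec m (x t)) t := by
  rw [hasDerivAt_pi] at hx ⊢
  intro s
  have h1 := (HasFDerivAt.multiset_prod (u := (s : Multiset (Fin n)))
    (fun i _ => (hx i).hasFDerivAt)).hasDerivAt.const_mul
      (√((s : Multiset (Fin n)).countPerms : ℝ))
  refine h1.congr_deriv ?_
  have key : ∀ k l : Fin n, k ∈ (s : Multiset (Fin n)) →
      ∑ s' : Sym (Fin n) m, (if l ::ₘ (s : Multiset (Fin n)).erase k = (s' : Multiset (Fin n)) then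
        ((s' : Multiset (Fin n)).map (x t)).prod else 0) =
      x t l * (((s : Multiset (Fin n)).erase k).map (x t)).prod := by
    intro k l hk
    have hc : Multiset.card (l ::ₘ (s : Multiset (Fin n)).erase k) = m := by
      rw [Multiset.card_cons, Multiset.card_erase_add_one hk]
      exact s.2
    let b₀ : Sym (Fin n) m := ⟨_, hc⟩
    refine (Finset.sum_eq_single b₀ ?_ ?_).trans ?_
    · intro b _ hb
      rw [if_neg]
      intro h
      exact hb (Subtype.ext h.symm)
    · simp
    · refine (if_pos rfl).trans ?_
      exact (congrArg Multiset.prod (Multiset.map_cons _ _ _)).trans (Multiset.prod_cons _ _)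
  rw [Finset.sum_multiset_map_count]
  simp only [sum_apply, smul_apply,
    Matrix.mulVec, dotProduct, lowerPower, powerVec, Matrix.of_apply]
  have hs : ∀ s' : Sym (Fin n) m, √((s' : Multiset (Fin n)).countPerms : ℝ) ≠ 0 := fun s' =>
    (Real.sqrt_pos.2 (Nat.cast_pos.2 (countPerms_pos _))).ne'
  have h2 : ∀ s' : Sym (Fin n) m,
      (√((s : Multiset (Fin n)).countPerms : ℝ) / √((s' : Multiset (Fin n)).countPerms : ℝ) *
      ∑ k, ∑ l, if l ::ₘ (s : Multiset (Fin n)).erase k = (s' : Multiset (Fin n)) then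
        ((s : Multiset (Fin n)).count k : ℝ) * A k l else 0) *
      (√((s' : Multiset (Fin n)).countPerms : ℝ) * ((s' : Multiset (Fin n)).map (x t)).prod) =
      √((s : Multiset (Fin n)).countPerms : ℝ) * ∑ k, ∑ l,
        ((s : Multiset (Fin n)).count k : ℝ) * A k l *
        (if l ::ₘ (s : Multiset (Fin n)).erase k = (s' : Multiset (Fin n)) then
          ((s' : Multiset (Fin n)).map (x t)).prod else 0) := by
    intro s'
    have : ∀ a b c d : ℝ, b ≠ 0 → a / b * c * (b * d) = a * (c * d) := by
      intro a b c d hb; field_simp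
    rw [this _ _ _ _ (hs s'), Finset.sum_mul]
    congr 1
    refine Finset.sum_congr rfl fun k _ => ?_
    rw [Finset.sum_mul]
    refine Finset.sum_congr rfl fun l _ => ?_
    split_ifs <;> simp
  rw [Finset.sum_congr rfl fun s' _ => h2 s', ← Finset.mul_sum, Finset.sum_comm]
  congr 1
  rw [Finset.sum_subset (Finset.subset_univ _)]
  · refine Finset.sum_congr rfl fun k _ => ?_
    rw [Finset.sum_comm]
    by_cases hk : k ∈ (s : Multiset (Fin n))
    · simp only [← Finset.mul_sum, key k _ hk]
      simp [Finset.mul_sum]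
      refine Finset.sum_congr rfl fun l _ => ?_
      ring
    · simp [Multiset.count_eq_zero.2 hk]
  · intro k _ hk
    simp [Multiset.count_eq_zero.2 (fun h => hk (Multiset.mem_toFinset.2 h))]

/-- A linear form that vanishes on all the vectors `x^[m]` is zero. -/
theorem eq_zero_of_powerVec {n m : ℕ} (v : Sym (Fin n) m → ℝ)
    (hv : ∀ x : Fin n → ℝ, v ⬝ᵥ powerVec m x = 0) : v = 0 := by
  classical
  let p : MvPolynomial (Fin n) ℝ := ∑ s : Sym (Fin n) m,
    MvPolynomial.monomial (Multiset.toFinsupp (s : Multiset (Fin n)))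
      (v s * √((s : Multiset (Fin n)).countPerms : ℝ))
  have hp : p = 0 := by
    refine MvPolynomial.funext fun x => ?_
    rw [map_zero, ← hv x]
    simp only [p, map_sum, MvPolynomial.eval_monomial, dotProduct, powerVec]
    refine Finset.sum_congr rfl fun s _ => ?_
    rw [mul_assoc]
    congr 2
    rw [Finset.prod_multiset_map_count, Finsupp.prod]
    simp
  funext s
  have h := congrArg (MvPolynomial.coeff (Multiset.toFinsupp (s : Multiset (Fin n)))) hp
  simp only [p, MvPolynomial.coeff_sum, MvPolynomial.coeff_monomial, MvPolynomial.coeff_zero] at h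
  rw [Finset.sum_eq_single s] at h
  · rw [if_pos rfl] at h
    exact (mul_eq_zero.1 h).resolve_right
      (Real.sqrt_pos.2 (Nat.cast_pos.2 (countPerms_pos _))).ne'
  · intro b _ hb
    rw [if_neg]
    intro h'
    exact hb (Subtype.ext (Multiset.toFinsupp.injective h'))
  · simp

/-- `A_[m]` is the only matrix `B` such that `dx/dt = A x` implies `d(x^[m])/dt = B x^[m]`. -/
theorem lowerPower_unique {n m : ℕ} (A : Matrix (Fin n) (Fin n) ℝ)
    (B : Matrix (Sym (Fin n) m) (Sym (Fin n) m) ℝ)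
    (hB : ∀ x : ℝ → Fin n → ℝ, (∀ t, HasDerivAt x (A *ᵥ x t) t) →
      ∀ t, HasDerivAt (fun u => powerVec m (x u)) (B *ᵥ powerVec m (x t)) t) :
    B = lowerPower m A := by
  have h : ∀ v : Fin n → ℝ, B *ᵥ powerVec m v = lowerPower m A *ᵥ powerVec m v := by
    intro v
    let L : (Fin n → ℝ) →L[ℝ] (Fin n → ℝ) := LinearMap.toContinuousLinearMap (Matrix.toLin' A)
    have hx : ∀ t, HasDerivAt (fun u : ℝ => NormedSpace.exp (u • L) v)
        (A *ᵥ (NormedSpace.exp (t • L) v)) t := by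
      intro t
      have := (hasDerivAt_exp_smul_const' (𝕂 := ℝ) L t).clm_apply (hasDerivAt_const t v)
      simpa [L] using this
    have h1 := hB _ hx 0
    have h2 := hasDerivAt_powerVec m A _ 0 (hx 0)
    simpa using h1.unique h2
  ext s s'
  have := eq_zero_of_powerVec (B s - lowerPower m A s) fun x => by
    rw [sub_dotProduct, sub_eq_zero]
    exact congrFun (h x) s
  exact sub_eq_zero.1 (congrFun this s')

end

/-! The moments `E[1_{r(t)=i} x(t)^[m]]` form a vector equal to `exp (t T)` applied to the initial
moments, where `T = meanMatrix m A Q`; this is `moment_eq`, and both implications follow from it.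

The identity is proved by discretization, without differentiating expectations. Freeze the mode on
each of `k` steps of length `t / k`. A step with mode `i` acts linearly on the monomials
(`powerVec_exp`), so the Markov property propagates the moments by a power of one matrix,
`stepMatrix` (`moment_frozenFlow`). Its right derivative at step length `0` is `T`, so these powers
tend to `exp (t T)` (`tendsto_pow_exp`). The frozen flows converge to the solution along almost
every path (`IsSolution.tendsto_frozenFlow`) and are uniformly bounded, so the moments converge too.

If `T` is Hurwitz, `exp (t T)` decays. For a nonnegative solution `‖x‖ ^ m` is at most the sum of
the entries of `x^[m]`; for Metzler matrices a general solution is dominated by the one started at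
`|x₀|`. Conversely, mean stability sends `exp (t T) u` to `0` for every initial moment vector `u`.
No nonzero linear form vanishes on all these `u`, so a left eigenvector of `T` excludes eigenvalues
with nonnegative real part. -/

noncomputable section

/-! ### The matrix exponential as a limit of powers. -/

section LinearAlgebra

open scoped Matrix.Norms.Operator
open NormedSpace (exp)

/-- Telescoping: the `k + 1` factors are exchanged one at a time, the other `k` costing at most `M`
each. -/
theorem norm_pow_sub_pow_le {𝔸 : Type*} [NormedRing 𝔸] [NormOneClass 𝔸] {a b : 𝔸} {M : ℝ}
    (ha : ‖a‖ ≤ M) (hb : ‖b‖ ≤ M) (k : ℕ) :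
    ‖a ^ (k + 1) - b ^ (k + 1)‖ ≤ (k + 1) * M ^ k * ‖a - b‖ := by
  have hM : 0 ≤ M := (norm_nonneg _).trans ha
  induction k with
  | zero => simp
  | succ k ih =>
    have h : a ^ (k + 1 + 1) - b ^ (k + 1 + 1) =
        a * (a ^ (k + 1) - b ^ (k + 1)) + (a - b) * b ^ (k + 1) := by
      rw [mul_sub, sub_mul, ← pow_succ', ← pow_succ']; abel
    rw [h]
    calc _ ≤ ‖a‖ * ‖a ^ (k + 1) - b ^ (k + 1)‖ + ‖a - b‖ * ‖b‖ ^ (k + 1) :=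
          (norm_add_le _ _).trans (add_le_add (norm_mul_le _ _)
            ((norm_mul_le _ _).trans (by gcongr; exact norm_pow_le _ _)))
      _ ≤ M * ((k + 1) * M ^ k * ‖a - b‖) + ‖a - b‖ * M ^ (k + 1) := by gcongr
      _ = _ := by push_cast; ring

/-- Sequences with the same first-order expansion at `1` have asymptotically equal powers. -/
theorem tendsto_pow_sub_pow {𝔸 : Type*} [NormedRing 𝔸] [NormOneClass 𝔸] [NormedAlgebra ℝ 𝔸]
    {a b : ℕ → 𝔸} {x : 𝔸} (ha : Tendsto (fun k : ℕ => (k : ℝ) • (a k - 1)) atTop (𝓝 x))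
    (hb : Tendsto (fun k : ℕ => (k : ℝ) • (b k - 1)) atTop (𝓝 x)) :
    Tendsto (fun k => a k ^ k - b k ^ k) atTop (𝓝 0) := by
  -- The bound is chosen so that all powers up to the `k`-th stay below `exp (‖x‖ + 1)`, uniformly
  -- in `k`.
  have bound : ∀ c : ℕ → 𝔸, Tendsto (fun k : ℕ => (k : ℝ) • (c k - 1)) atTop (𝓝 x) →
      ∀ᶠ k : ℕ in atTop, ‖c k‖ ≤ Real.exp ((‖x‖ + 1) / k) := by
    intro c hc
    filter_upwards [hc.norm.eventually_le_const (lt_add_one ‖x‖), eventually_gt_atTop 0]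
      with k hk hk0
    have hk0 : (0 : ℝ) < k := by exact_mod_cast hk0
    rw [norm_smul, Real.norm_of_nonneg hk0.le, mul_comm, ← le_div_iff₀ hk0] at hk
    calc ‖c k‖ = ‖(c k - 1) + 1‖ := by simp
      _ ≤ ‖c k - 1‖ + ‖(1 : 𝔸)‖ := norm_add_le _ _
      _ ≤ (‖x‖ + 1) / k + 1 := by rw [norm_one]; gcongr
      _ ≤ _ := Real.add_one_le_exp _
  have hab := (ha.sub hb).norm
  simp only [← smul_sub, sub_sub_sub_cancel_right, sub_self, norm_zero] at hab
  refine squeeze_zero_norm' ?_ (by simpa using hab.const_mul (Real.exp (‖x‖ + 1)))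
  filter_upwards [bound a ha, bound b hb, eventually_gt_atTop 0] with k hka hkb hk0
  obtain ⟨j, rfl⟩ : ∃ j, k = j + 1 := ⟨k - 1, by omega⟩
  refine (norm_pow_sub_pow_le hka hkb j).trans ?_
  rw [norm_smul, Real.norm_of_nonneg (by positivity), ← Real.exp_nat_mul, mul_comm _ (Real.exp _),
    mul_assoc]
  push_cast
  gcongr
  rw [mul_div_assoc', div_le_iff₀ (by positivity)]
  nlinarith [norm_nonneg x]

/-- Slopes of `G` along `t / k`, rescaled by `t`: this supplies the hypotheses of
`tendsto_pow_sub_pow`. -/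
theorem tendsto_smul_sub_one_of_hasDerivWithinAt {E : Type*} [NormedAddCommGroup E]
    [NormedSpace ℝ E] {G : ℝ → E} {T : E}
    (hG : HasDerivWithinAt G T (Ioi 0) 0) {t : ℝ} (ht : 0 < t) :
    Tendsto (fun k : ℕ => (k : ℝ) • (G (t / k) - G 0)) atTop (𝓝 (t • T)) := by
  rw [hasDerivWithinAt_iff_tendsto_slope' (by simp)] at hG
  have h1 : Tendsto (fun k : ℕ => t / (k : ℝ)) atTop (𝓝[>] 0) := by
    refine tendsto_nhdsWithin_iff.2 ⟨tendsto_const_div_atTop_nhds_zero_nat t, ?_⟩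
    filter_upwards [eventually_gt_atTop 0] with k hk
    have : (0 : ℝ) < k := by exact_mod_cast hk
    exact div_pos ht this
  refine ((hG.comp h1).const_smul t).congr' ?_
  filter_upwards [eventually_gt_atTop 0] with k hk
  have : (k : ℝ) ≠ 0 := by positivity
  simp only [Function.comp, slope_def_module, sub_zero, smul_smul]
  congr 1
  field_simp

variable {ι : Type*} [Fintype ι] [DecidableEq ι]

theorem hasDerivAt_exp_smul (T : Matrix ι ι ℝ) (t : ℝ) :
    HasDerivAt (fun u : ℝ => exp (u • T)) (T * exp (t • T)) t :=
  hasDerivAt_exp_smul_const' (𝕂 := ℝ) T t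

/-- The exponential formula `G (t / k) ^ k → exp (t G'(0))`. -/
theorem tendsto_pow_exp {G : ℝ → Matrix ι ι ℝ} {T : Matrix ι ι ℝ} (h1 : G 0 = 1)
    (hG : HasDerivWithinAt G T (Ioi 0) 0) {t : ℝ} (ht : 0 ≤ t) :
    Tendsto (fun k : ℕ => G (t / k) ^ k) atTop (𝓝 (exp (t • T))) := by
  rcases isEmpty_or_nonempty ι with hι | hι
  · exact tendsto_const_nhds.congr fun k => Subsingleton.elim _ _
  rcases ht.eq_or_lt with rfl | ht
  · simp [h1, NormedSpace.exp_zero]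
  -- The comparison sequence is `exp ((t / k) T)`: it has the same first-order expansion and its
  -- `k`-th power is exactly `exp (t T)`.
  have hE : HasDerivWithinAt (fun u : ℝ => exp (u • T)) T (Ioi 0) 0 := by
    have := (hasDerivAt_exp_smul T 0).hasDerivWithinAt (s := Ioi 0)
    rwa [zero_smul, NormedSpace.exp_zero, mul_one] at this
  have ha := tendsto_smul_sub_one_of_hasDerivWithinAt hG ht
  have hb := tendsto_smul_sub_one_of_hasDerivWithinAt hE ht
  simp only [h1, zero_smul, NormedSpace.exp_zero] at ha hb
  have := (tendsto_pow_sub_pow ha hb).add_const (exp (t • T))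
  rw [zero_add] at this
  refine this.congr' ?_
  filter_upwards [eventually_gt_atTop 0] with k hk
  have hk : (k : ℝ) ≠ 0 := by positivity
  rw [← Matrix.exp_nsmul, ← Nat.cast_smul_eq_nsmul ℝ, smul_smul, mul_div_cancel₀ _ hk,
    sub_add_cancel]

/-- The exponential of a Metzler matrix is entrywise nonnegative. -/
theorem IsMetzler.exp_nonneg {n : ℕ} {A : Matrix (Fin n) (Fin n) ℝ} (hA : IsMetzler A) {t : ℝ}
    (ht : 0 ≤ t) (i j : Fin n) : 0 ≤ exp (t • A) i j := by
  -- Euler's approximation `(1 + (t / k) A) ^ k` has nonnegative entries once `k` is large enough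
  -- for the diagonal of the factor.
  have hG : HasDerivWithinAt (fun u : ℝ => 1 + u • A) A (Ioi 0) 0 := by
    have := (((hasDerivAt_id (0 : ℝ)).smul_const A).const_add 1).hasDerivWithinAt (s := Ioi 0)
    rwa [one_smul] at this
  have hlim := tendsto_pow_exp (by simp) hG ht
  have hij : Tendsto (fun k : ℕ => ((1 + (t / k) • A) ^ k) i j) atTop (𝓝 (exp (t • A) i j)) :=
    (tendsto_pi_nhds.1 (tendsto_pi_nhds.1 hlim i) j)
  have hsmall : ∀ i : Fin n, ∀ᶠ k : ℕ in atTop, 0 ≤ 1 + t / (k : ℝ) * A i i := by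
    intro i
    have : Tendsto (fun k : ℕ => 1 + t / (k : ℝ) * A i i) atTop (𝓝 (1 + 0 * A i i)) :=
      ((tendsto_const_div_atTop_nhds_zero_nat t).mul_const _).const_add 1
    exact this.eventually_const_le (by simp)
  refine ge_of_tendsto hij ?_
  filter_upwards [eventually_all.2 hsmall] with k hk
  have h1 : ∀ i j, 0 ≤ (1 + (t / (k : ℝ)) • A) i j := by
    intro i j
    rcases eq_or_ne i j with rfl | h
    · simpa using hk i
    · simpa [Matrix.one_apply_ne h] using mul_nonneg (div_nonneg ht k.cast_nonneg) (hA i j h)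
  have h2 : ∀ l : ℕ, ∀ i j, 0 ≤ ((1 + (t / (k : ℝ)) • A) ^ l) i j := by
    intro l
    induction l with
    | zero => intro i j; rw [pow_zero, Matrix.one_apply]; split_ifs <;> simp
    | succ l ih =>
      intro i j
      rw [pow_succ, Matrix.mul_apply]
      exact Finset.sum_nonneg fun p _ => mul_nonneg (ih i p) (h1 p j)
  exact h2 k i j

theorem hasDerivAt_exp_smul_mulVec (T : Matrix ι ι ℝ) (v : ι → ℝ) (t : ℝ) :
    HasDerivAt (fun u : ℝ => exp (u • T) *ᵥ v) (T *ᵥ (exp (t • T) *ᵥ v)) t := by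
  have h : HasDerivAt (fun u : ℝ => exp (u • T) *ᵥ v) ((T * exp (t • T)) *ᵥ v) t :=
    (LinearMap.toContinuousLinearMap
      ((Matrix.mulVecBilin ℝ ℝ).flip v : Matrix ι ι ℝ →ₗ[ℝ] ι → ℝ)).hasFDerivAt.comp_hasDerivAt t
        (hasDerivAt_exp_smul T t)
  rwa [← Matrix.mulVec_mulVec] at h

/-- A solution of `y' = T y` is `y t = exp (t T) y 0`. -/
theorem eq_exp_smul_mulVec_of_hasDerivAt {T : Matrix ι ι ℝ} {y : ℝ → ι → ℝ}
    (hy : ∀ t, HasDerivAt y (T *ᵥ y t) t) (t : ℝ) : y t = exp (t • T) *ᵥ y 0 := by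
  have hL : ∀ t : ℝ, LipschitzOnWith ‖T‖₊ (fun v => T *ᵥ v) (univ : Set (ι → ℝ)) := fun _ =>
    (LipschitzWith.of_dist_le_mul fun v w => by
      rw [dist_eq_norm, dist_eq_norm, ← Matrix.mulVec_sub]
      exact Matrix.linfty_opNorm_mulVec _ _).lipschitzOnWith
  have := ODE_solution_unique_univ (t₀ := 0) (v := fun _ v => T *ᵥ v) (s := fun _ => univ) hL
    (fun t => ⟨hy t, mem_univ _⟩) (fun t => ⟨hasDerivAt_exp_smul_mulVec T (y 0) t, mem_univ _⟩)
    (by simp [NormedSpace.exp_zero])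
  exact congrFun this t

/-- Both sides solve the linear equation with matrix `lowerPower m A`. This makes a step with frozen
mode linear in the monomials. -/
theorem powerVec_exp {n : ℕ} (m : ℕ) (A : Matrix (Fin n) (Fin n) ℝ) (v : Fin n → ℝ) (t : ℝ) :
    powerVec m (exp (t • A) *ᵥ v) = exp (t • lowerPower m A) *ᵥ powerVec m v := by
  have := eq_exp_smul_mulVec_of_hasDerivAt (y := fun u : ℝ => powerVec m (exp (u • A) *ᵥ v))
    (fun u => hasDerivAt_powerVec m A (fun u : ℝ => exp (u • A) *ᵥ v) u
      (hasDerivAt_exp_smul_mulVec A v u)) t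
  simpa [NormedSpace.exp_zero] using this

end LinearAlgebra

/-! ### Hurwitz stability and decay of the exponential. -/

section Hurwitz

open scoped Matrix.Norms.Operator
open NormedSpace (exp)

variable {ι : Type*} [Fintype ι] [DecidableEq ι]

theorem norm_map_algebraMap (M : Matrix ι ι ℝ) : ‖M.map (algebraMap ℝ ℂ)‖ = ‖M‖ := by
  simp [Matrix.linfty_opNorm_def]

theorem map_exp_smul (T : Matrix ι ι ℝ) (t : ℝ) :
    (exp (t • T)).map (algebraMap ℝ ℂ) = exp ((t : ℂ) • T.map (algebraMap ℝ ℂ)) := by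
  have hc : Continuous ((algebraMap ℝ ℂ).mapMatrix : Matrix ι ι ℝ →+* Matrix ι ι ℂ) := by
    refine continuous_matrix fun i j => ?_
    exact Complex.continuous_ofReal.comp ((continuous_apply j).comp (continuous_apply i))
  have := NormedSpace.map_exp ((algebraMap ℝ ℂ).mapMatrix : Matrix ι ι ℝ →+* Matrix ι ι ℂ) hc
    (t • T)
  simp only [RingHom.mapMatrix_apply] at this
  refine this.trans (congrArg _ ?_)
  ext i j
  simp

theorem exp_mulVec_of_mulVec_eq_smul {T : Matrix ι ι ℂ} {v : ι → ℂ} {μ : ℂ} (h : T *ᵥ v = μ • v) :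
    exp T *ᵥ v = Complex.exp μ • v := by
  have hpow : ∀ k : ℕ, T ^ k *ᵥ v = μ ^ k • v := by
    intro k
    induction k with
    | zero => simp
    | succ k ih => 
      rw [pow_succ', ← Matrix.mulVec_mulVec, ih, Matrix.mulVec_smul, h, smul_smul, ← pow_succ]
  have h1 : HasSum (fun k : ℕ => ((k.factorial : ℂ)⁻¹ • T ^ k) *ᵥ v) (exp T *ᵥ v) :=
    (NormedSpace.exp_series_hasSum_exp' (𝕂 := ℂ) T).map
      ((Matrix.mulVecBilin ℂ ℂ).flip v : Matrix ι ι ℂ →ₗ[ℂ] ι → ℂ)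
      (LinearMap.continuous_of_finiteDimensional _)
  have h2 : HasSum (fun k : ℕ => ((k.factorial : ℂ)⁻¹ • μ ^ k) • v) (Complex.exp μ • v) := by
    rw [Complex.exp_eq_exp_ℂ]
    exact (NormedSpace.exp_series_hasSum_exp' (𝕂 := ℂ) μ).smul_const v
  refine h1.unique (h2.congr_fun ?_)
  intro k
  rw [Matrix.smul_mulVec, hpow, smul_smul, smul_eq_mul]

/-- Every eigenvalue of `exp T` is the exponential of an eigenvalue of `T`. -/
theorem exists_hasEigenvalue_of_exp (T : Matrix ι ι ℂ) {c : ℂ} (hc : c ∈ spectrum ℂ (exp T)) :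
    ∃ μ : ℂ, Module.End.HasEigenvalue (Matrix.toLin' T) μ ∧ c = Complex.exp μ := by
  rw [← Matrix.spectrum_toLin', ← Module.End.hasEigenvalue_iff_mem_spectrum] at hc
  -- `T` commutes with `exp T` and so preserves this eigenspace; an eigenvector of `T` inside it is
  -- common to both.
  let W := Module.End.eigenspace (Matrix.toLin' (exp T)) c
  have hcomm : Commute (Matrix.toLin' T) (Matrix.toLin' (exp T)) := by
    have : Commute T (exp T) := (Commute.refl T).exp_right
    rw [commute_iff_eq, Module.End.mul_eq_comp, Module.End.mul_eq_comp, ← Matrix.toLin'_mul,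
      ← Matrix.toLin'_mul, this.eq]
  have hW : MapsTo (Matrix.toLin' T) W W :=
    Module.End.mapsTo_genEigenspace_of_comm hcomm.symm c 1
  have : Nontrivial W := Submodule.nontrivial_iff_ne_bot.2 hc
  obtain ⟨μ, hμ⟩ := Module.End.exists_eigenvalue ((Matrix.toLin' T).restrict hW)
  obtain ⟨w, hw⟩ := hμ.exists_hasEigenvector
  have hw1 : T *ᵥ (w : ι → ℂ) = μ • (w : ι → ℂ) :=
    congrArg Subtype.val hw.apply_eq_smul
  have hw0 : (w : ι → ℂ) ≠ 0 := fun h => hw.2 (Subtype.ext h)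
  refine ⟨μ, Module.End.hasEigenvalue_of_hasEigenvector (x := (w : ι → ℂ))
    ⟨Module.End.mem_eigenspace_iff.2 (by simpa using hw1), hw0⟩, ?_⟩
  have h1 : exp T *ᵥ (w : ι → ℂ) = c • (w : ι → ℂ) := by
    simpa using Module.End.mem_eigenspace_iff.1 w.2
  rw [exp_mulVec_of_mulVec_eq_smul hw1] at h1
  exact (smul_left_injective ℂ hw0 h1).symm

/-- Since `|exp μ| = exp (Re μ)`, the spectral radius of `exp T` is below `1`, and Gelfand's formula
yields a power `exp T ^ k = exp (k T)` of norm below `1`. -/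
theorem IsHurwitz.exists_norm_exp_lt_one {T : Matrix ι ι ℝ} (hT : IsHurwitz T) :
    ∃ s : ℝ, 0 < s ∧ ‖exp (s • T)‖ < 1 := by
  rcases isEmpty_or_nonempty ι with hι | hι
  · exact ⟨1, one_pos, by rw [Subsingleton.elim (exp _) 0, norm_zero]; exact one_pos⟩
  let B := T.map (algebraMap ℝ ℂ)
  have hspec : spectralRadius ℂ (exp B) < (1 : NNReal) := by
    refine spectrum.spectralRadius_lt_of_forall_lt _ fun z hz => ?_
    obtain ⟨μ, hμ, rfl⟩ := exists_hasEigenvalue_of_exp B hz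
    rw [← NNReal.coe_lt_coe, coe_nnnorm, Complex.norm_exp, NNReal.coe_one, Real.exp_lt_one_iff]
    exact hT μ hμ
  have hlim := (spectrum.pow_nnnorm_pow_one_div_tendsto_nhds_spectralRadius (exp B)).eventually_lt_const
    hspec
  obtain ⟨k, hk, hk0⟩ := (hlim.and (eventually_gt_atTop 0)).exists
  refine ⟨k, by exact_mod_cast hk0, ?_⟩
  have h1 : (‖exp B ^ k‖₊ : ENNReal) < 1 := by
    by_contra! h
    exact hk.not_ge (by simpa using ENNReal.one_le_rpow h (by positivity))
  rw [← norm_map_algebraMap, map_exp_smul]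
  have h2 : exp ((((k : ℝ) : ℂ)) • B) = exp B ^ k := by
    rw [← Matrix.exp_nsmul, ← Nat.cast_smul_eq_nsmul ℂ]; simp
  rw [h2, ← coe_nnnorm]
  exact_mod_cast h1

/-- The matrix exponential of a Hurwitz stable matrix decays exponentially. -/
theorem IsHurwitz.exp_decay {T : Matrix ι ι ℝ} (hT : IsHurwitz T) :
    ∃ C β : ℝ, 0 < C ∧ 0 < β ∧ ∀ t, 0 ≤ t → ‖exp (t • T)‖ ≤ C * Real.exp (-β * t) := by
  obtain ⟨s, hs, hs1⟩ := hT.exists_norm_exp_lt_one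
  have hcont : Continuous fun u : ℝ => exp (u • T) :=
    continuous_iff_continuousAt.2 fun u => (hasDerivAt_exp_smul T u).continuousAt
  obtain ⟨K, hK⟩ := (isCompact_Icc (a := (0 : ℝ)) (b := s)).exists_bound_of_continuousOn
    hcont.continuousOn
  -- The maximum keeps `q` positive even for an empty index type, so that `log q` makes sense.
  set q : ℝ := max ‖exp (s • T)‖ (1 / 2) with hq
  have hq0 : 0 < q := lt_max_of_lt_right (by norm_num)
  have hq1 : q < 1 := max_lt hs1 (by norm_num)
  have hlog : Real.log q < 0 := Real.log_neg hq0 hq1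
  have hpow : ∀ (j : ℕ) (M : Matrix ι ι ℝ), ‖M * exp (s • T) ^ j‖ ≤ ‖M‖ * q ^ j := by
    intro j M
    induction j with
    | zero => simp
    | succ j ih =>
      rw [pow_succ, ← mul_assoc, pow_succ, ← mul_assoc]
      exact (norm_mul_le _ _).trans (mul_le_mul ih (le_max_left _ _) (norm_nonneg _) (by positivity))
  -- With `j = ⌊t / s⌋` the decay is `q ^ j = q ^ (j + 1) / q`, and `t < (j + 1) s`; this accounts
  -- for the factor `1 / q`. `K` bounds the remaining time in `[0, s]`.
  refine ⟨max K 1 / q, -(Real.log q / s), by positivity, by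
    rw [neg_pos]; exact div_neg_of_neg_of_pos hlog hs, fun t ht => ?_⟩
  set j := ⌊t / s⌋₊ with hj
  have hjle : j * s ≤ t := by
    rw [← le_div_iff₀ hs]; exact Nat.floor_le (by positivity)
  have hjlt : t < (j + 1) * s := by
    rw [← div_lt_iff₀ hs]; exact Nat.lt_floor_add_one _
  have hsplit : exp (t • T) = exp ((t - j * s) • T) * exp (s • T) ^ j := by
    rw [← Matrix.exp_nsmul, ← Matrix.exp_add_of_commute, ← Nat.cast_smul_eq_nsmul ℝ, smul_smul,
      ← add_smul, sub_add_cancel]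
    rw [← Nat.cast_smul_eq_nsmul ℝ, smul_smul]
    exact ((Commute.refl T).smul_left _).smul_right _
  rw [hsplit]
  refine (hpow j _).trans ?_
  have hqj : q ^ j ≤ 1 / q * Real.exp (-(-(Real.log q / s)) * t) := by
    have : q ^ (j + 1) ≤ Real.exp (Real.log q / s * t) := by
      rw [← Real.exp_log (pow_pos hq0 _), Real.log_pow]
      refine Real.exp_le_exp.2 ?_
      push_cast
      have : Real.log q / s * t = t / s * Real.log q := by ring
      rw [this]
      exact mul_le_mul_of_nonpos_right ((div_le_iff₀ hs).2 hjlt.le) hlog.le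
    rw [neg_neg, one_div, inv_mul_eq_div, le_div_iff₀ hq0, ← pow_succ]
    exact this
  calc _ ≤ max K 1 * (1 / q * Real.exp (-(-(Real.log q / s)) * t)) :=
        mul_le_mul ((hK _ ⟨by linarith, by linarith⟩).trans (le_max_left _ _)) hqj (by positivity)
          (by positivity)
    _ = _ := by ring

/-- A complex eigenvalue of `T` has a left eigenvector. -/
theorem exists_vecMul_eq_smul {T : Matrix ι ι ℂ} {μ : ℂ}
    (hμ : Module.End.HasEigenvalue (Matrix.toLin' T) μ) :
    ∃ w : ι → ℂ, w ≠ 0 ∧ Tᵀ *ᵥ w = μ • w := by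
  have h : Module.End.HasEigenvalue (Matrix.toLin' Tᵀ) μ := by
    rw [Module.End.hasEigenvalue_iff_isRoot_charpoly] at hμ ⊢
    rwa [Matrix.charpoly_toLin', Matrix.charpoly_transpose, ← Matrix.charpoly_toLin']
  obtain ⟨w, hw⟩ := h.exists_hasEigenvector
  exact ⟨w, hw.2, by simpa using hw.apply_eq_smul⟩

/-- If `exp (t T) u → 0` for all `u` in a set on which no nonzero linear form vanishes, then `T`
is Hurwitz stable. -/
theorem isHurwitz_of_tendsto {T : Matrix ι ι ℝ} (S : Set (ι → ℝ))
    (hS : ∀ w : ι → ℝ, (∀ u ∈ S, w ⬝ᵥ u = 0) → w = 0)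
    (hlim : ∀ u ∈ S, Tendsto (fun t : ℝ => exp (t • T) *ᵥ u) atTop (𝓝 0)) : IsHurwitz T := by
  intro μ hμ
  by_contra! hre
  obtain ⟨w, hw0, hw⟩ := exists_vecMul_eq_smul hμ
  -- `w ⬝ᵥ exp (t T) u = exp (t μ) (w ⬝ᵥ u)` tends to `0`, while `|exp (t μ)| ≥ 1`.
  have key : ∀ u ∈ S, w ⬝ᵥ (fun i => (u i : ℂ)) = 0 := by
    intro u hu
    have h1 : ∀ t : ℝ, w ⬝ᵥ (fun i => ((exp (t • T) *ᵥ u) i : ℂ)) =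
        Complex.exp (t * μ) * (w ⬝ᵥ fun i => (u i : ℂ)) := by
      intro t
      have h2 : (fun i => ((exp (t • T) *ᵥ u) i : ℂ)) =
          exp ((t : ℂ) • T.map (algebraMap ℝ ℂ)) *ᵥ (fun i => (u i : ℂ)) := by
        rw [← map_exp_smul]
        ext i
        simp [Matrix.mulVec, dotProduct]
      have h3 : ((t : ℂ) • T.map (algebraMap ℝ ℂ))ᵀ *ᵥ w = (t * μ) • w := by
        rw [Matrix.transpose_smul, Matrix.smul_mulVec, hw, smul_smul]
      rw [h2, Matrix.dotProduct_mulVec, ← Matrix.mulVec_transpose, ← Matrix.exp_transpose,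
        exp_mulVec_of_mulVec_eq_smul h3, smul_dotProduct, smul_eq_mul]
    have h4 : Tendsto (fun t : ℝ => w ⬝ᵥ (fun i => ((exp (t • T) *ᵥ u) i : ℂ))) atTop (𝓝 0) := by
      have hc : Continuous fun z : ι → ℝ => w ⬝ᵥ (fun i => (z i : ℂ)) := by
        unfold dotProduct; fun_prop
      have := (hc.tendsto 0).comp (hlim u hu)
      simpa [dotProduct, Function.comp_def] using this
    have h5 : Tendsto (fun t : ℝ => ‖w ⬝ᵥ (fun i => ((exp (t • T) *ᵥ u) i : ℂ))‖) atTop (𝓝 0) := by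
      simpa using h4.norm
    rw [← norm_le_zero_iff]
    refine ge_of_tendsto h5 ?_
    filter_upwards [eventually_ge_atTop 0] with t ht
    rw [h1, norm_mul, Complex.norm_exp]
    refine le_mul_of_one_le_left (norm_nonneg _) (Real.one_le_exp ?_)
    simpa using mul_nonneg ht hre
  -- The vectors of `S` are real, so the real and imaginary parts of `w` annihilate them separately.
  have hr : (fun i => (w i).re) = 0 := hS _ fun u hu => by
    simpa [dotProduct] using congrArg Complex.re (key u hu)
  have hi : (fun i => (w i).im) = 0 := hS _ fun u hu => by
    simpa [dotProduct] using congrArg Complex.im (key u hu)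
  exact hw0 (funext fun i => Complex.ext (congrFun hr i) (congrFun hi i))

end Hurwitz

/-! ### Approximation of solutions by flows with frozen modes. -/

section Flow

open scoped Matrix.Norms.Operator
open NormedSpace (exp)

/-- A path without accumulation of jumps has finitely many jumps in `[0, T]`. -/
theorem exists_finset_eq_of_cadlag {α : Type*} {ρ : ℝ → α}
    (hright : ∀ t, 0 ≤ t → ∀ᶠ u in 𝓝[>] t, ρ u = ρ t)
    (hleft : ∀ t, 0 < t → ∃ j, ∀ᶠ u in 𝓝[<] t, ρ u = j) (T : ℝ) :
    ∃ F : Finset ℝ, ∀ a b, 0 ≤ a → b ≤ T → (∀ f ∈ F, f ∉ Ioo a b) → ∀ s ∈ Ico a b, ρ s = ρ a := by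
  have hopen : ∀ (U : Set ℝ) (t : ℝ) (c : α), IsOpen U → (∀ᶠ u in 𝓝[U] t, ρ u = c) →
      ∀ᶠ s in 𝓝 t, s ∈ U → ∀ᶠ u in 𝓝 s, ρ u = ρ s := by
    intro U t c hU h
    rw [← eventually_eventually_nhdsWithin, eventually_nhdsWithin_iff] at h
    filter_upwards [h] with s hs hsU
    have hs := hs hsU
    rw [hU.nhdsWithin_eq hsU] at hs
    filter_upwards [hs] with u hu
    exact hu.trans hs.self_of_nhds.symm
  -- Each point has a neighborhood in which it is the only possible positive jump time; compactness
  -- leaves finitely many.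
  have hloc : ∃ F : Finset ℝ, ∀ s ∈ Icc 0 T, 0 < s → s ∉ F → ∀ᶠ u in 𝓝 s, ρ u = ρ s := by
    refine (isCompact_Icc (a := (0 : ℝ)) (b := T)).induction_on
      (p := fun S => ∃ F : Finset ℝ, ∀ s ∈ S, 0 < s → s ∉ F → ∀ᶠ u in 𝓝 s, ρ u = ρ s)
      ⟨∅, by simp⟩ (fun S S' hS ⟨F, hF⟩ => ⟨F, fun s hs => hF s (hS hs)⟩) ?_ ?_
    · classical
      rintro S S' ⟨F, hF⟩ ⟨F', hF'⟩
      refine ⟨F ∪ F', fun s hs h0 hsF => ?_⟩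
      rw [Finset.mem_union, not_or] at hsF
      exact hs.elim (fun h => hF s h h0 hsF.1) (fun h => hF' s h h0 hsF.2)
    · intro t ht
      have hl : ∀ᶠ s in 𝓝 t, s ∈ Iio t → 0 < s → ∀ᶠ u in 𝓝 s, ρ u = ρ s := by
        rcases ht.1.eq_or_lt with rfl | h0
        · exact Eventually.of_forall fun s hs h => absurd hs h.not_gt
        · obtain ⟨j, hj⟩ := hleft t h0
          filter_upwards [hopen _ t j isOpen_Iio hj] with s hs h _ using hs h
      refine ⟨{s | 0 < s → s ≠ t → ∀ᶠ u in 𝓝 s, ρ u = ρ s}, mem_nhdsWithin_of_mem_nhds ?_, {t},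
        fun s hs h0 hst => hs h0 (by simpa using hst)⟩
      filter_upwards [hl, hopen _ t _ isOpen_Ioi (hright t ht.1)] with s hs1 hs2 h0 hne
      exact hne.lt_or_gt.elim (fun h => hs1 h h0) hs2
  obtain ⟨F, hF⟩ := hloc
  refine ⟨F, fun a b ha hb hab s hs => ?_⟩
  rcases hs.1.eq_or_lt with rfl | hs1
  · rfl
  let _ : TopologicalSpace α := ⊥
  have : DiscreteTopology α := ⟨rfl⟩
  have hcont : ContinuousOn ρ (Ioo a b) := by
    intro u hu
    refine ContinuousAt.continuousWithinAt ?_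
    have h0 : 0 < u := ha.trans_lt hu.1
    exact tendsto_const_nhds.congr'
      ((hF u ⟨h0.le, hu.2.le.trans hb⟩ h0 fun h => hab u h hu).mono fun _ h => h.symm)
  obtain ⟨u, hu, hu'⟩ := ((hright a ha).and (Ioo_mem_nhdsGT (hs1.trans hs.2))).exists
  rw [← hu]
  exact isPreconnected_Ioo.constant hcont ⟨hs1, hs.2⟩ hu'

variable {n N : ℕ}

/-- The product of the flows over `k` steps of length `h`, the mode being frozen on each step. -/
def frozenFlow (A : Fin N → Matrix (Fin n) (Fin n) ℝ) (ρ : ℝ → Fin N) (h : ℝ) :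
    ℕ → Matrix (Fin n) (Fin n) ℝ
  | 0 => 1
  | k + 1 => exp (h • A (ρ (k * h))) * frozenFlow A ρ h k

theorem norm_exp_smul_mulVec_le {ι : Type*} [Fintype ι] [DecidableEq ι] {A : Matrix ι ι ℝ} {M : ℝ}
    (hA : ‖A‖ ≤ M) {h : ℝ} (hh : 0 ≤ h) (v : ι → ℝ) :
    ‖exp (h • A) *ᵥ v‖ ≤ ‖v‖ * Real.exp (M * h) := by
  have := norm_le_gronwallBound_of_norm_deriv_right_le (f := fun u : ℝ => exp (u • A) *ᵥ v)
    (a := 0) (b := h) (δ := ‖v‖) (K := M) (ε := 0)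
    (fun u _ => (hasDerivAt_exp_smul_mulVec A v u).continuousAt.continuousWithinAt)
    (fun u _ => (hasDerivAt_exp_smul_mulVec A v u).hasDerivWithinAt)
    (by simp [NormedSpace.exp_zero])
    (fun u _ => by
      rw [add_zero]
      exact (Matrix.linfty_opNorm_mulVec _ _).trans (by gcongr)) h ⟨hh, le_rfl⟩
  simpa [gronwallBound_ε0] using this

/-- For `h = t / k` the bound depends only on `t`, which is what dominated convergence needs. -/
theorem norm_frozenFlow_mulVec_le {A : Fin N → Matrix (Fin n) (Fin n) ℝ} {M : ℝ}
    (hA : ∀ i, ‖A i‖ ≤ M) (ρ : ℝ → Fin N) {h : ℝ} (hh : 0 ≤ h) (v : Fin n → ℝ) (k : ℕ) :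
    ‖frozenFlow A ρ h k *ᵥ v‖ ≤ ‖v‖ * Real.exp (M * (k * h)) := by
  induction k with
  | zero => simp [frozenFlow]
  | succ k ih =>
    rw [frozenFlow, ← Matrix.mulVec_mulVec]
    refine (norm_exp_smul_mulVec_le (hA _) hh _).trans ?_
    refine (mul_le_mul_of_nonneg_right ih (Real.exp_pos _).le).trans_eq ?_
    rw [mul_assoc, ← Real.exp_add]
    push_cast
    ring_nf

theorem frozenFlow_nonneg {A : Fin N → Matrix (Fin n) (Fin n) ℝ} (hA : ∀ i, IsMetzler (A i))
    (ρ : ℝ → Fin N) {h : ℝ} (hh : 0 ≤ h) (k : ℕ) (i j : Fin n) : 0 ≤ frozenFlow A ρ h k i j := by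
  induction k generalizing i j with
  | zero => rw [frozenFlow, Matrix.one_apply]; split_ifs <;> simp
  | succ k ih =>
    rw [frozenFlow, Matrix.mul_apply]
    exact Finset.sum_nonneg fun p _ => mul_nonneg ((hA _).exp_nonneg hh i p) (ih p j)

variable {A : Fin N → Matrix (Fin n) (Fin n) ℝ} {ρ : ℝ → Fin N} {v : Fin n → ℝ}
  {y : ℝ → Fin n → ℝ}

/-- The error of freezing the mode of a solution at time `a`. -/
theorem IsSolution.norm_sub_exp_le (hy : IsSolution A ρ v y) {M ε a b : ℝ} (ha : 0 ≤ a)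
    (hab : a ≤ b) (hA : ∀ i, ‖A i‖ ≤ M)
    (hε : ∀ s ∈ Ico a b, ‖(A (ρ s) - A (ρ a)) *ᵥ y s‖ ≤ ε) :
    ‖y b - exp ((b - a) • A (ρ a)) *ᵥ y a‖ ≤ gronwallBound 0 M ε (b - a) := by
  have hz : ∀ s, HasDerivAt (fun s : ℝ => exp ((s - a) • A (ρ a)) *ᵥ y a)
      (A (ρ a) *ᵥ (exp ((s - a) • A (ρ a)) *ᵥ y a)) s := fun s =>
    (hasDerivAt_exp_smul_mulVec (A (ρ a)) (y a) (s - a)).comp_sub_const s a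
  refine norm_le_gronwallBound_of_norm_deriv_right_le
    (f := fun s => y s - exp ((s - a) • A (ρ a)) *ᵥ y a)
    (f' := fun s => A (ρ s) *ᵥ y s - A (ρ a) *ᵥ (exp ((s - a) • A (ρ a)) *ᵥ y a))
    ((hy.continuousOn.mono fun s hs => ha.trans hs.1).sub
      fun s _ => (hz s).continuousAt.continuousWithinAt)
    (fun s hs => (hy.deriv s (ha.trans hs.1)).sub (hz s).hasDerivWithinAt)
    (by simp [NormedSpace.exp_zero]) (fun s hs => ?_) b ⟨hab, le_rfl⟩
  have : A (ρ s) *ᵥ y s - A (ρ a) *ᵥ (exp ((s - a) • A (ρ a)) *ᵥ y a) =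
      A (ρ a) *ᵥ (y s - exp ((s - a) • A (ρ a)) *ᵥ y a) + (A (ρ s) - A (ρ a)) *ᵥ y s := by
    rw [Matrix.mulVec_sub, Matrix.sub_mulVec]; abel
  rw [this]
  refine (norm_add_le _ _).trans (add_le_add ?_ (hε s hs))
  exact (Matrix.linfty_opNorm_mulVec _ _).trans (by gcongr; exact hA _)

/-- Solutions along a piecewise constant path are limits of frozen flows. -/
theorem IsSolution.tendsto_frozenFlow (hy : IsSolution A ρ v y)
    (hright : ∀ t, 0 ≤ t → ∀ᶠ u in 𝓝[>] t, ρ u = ρ t)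
    (hleft : ∀ t, 0 < t → ∃ j, ∀ᶠ u in 𝓝[<] t, ρ u = j) {t : ℝ} (ht : 0 ≤ t) :
    Tendsto (fun k : ℕ => frozenFlow A ρ (t / k) k *ᵥ v) atTop (𝓝 (y t)) := by
  classical
  obtain ⟨F, hF⟩ := exists_finset_eq_of_cadlag hright hleft t
  obtain ⟨B, hB⟩ := (isCompact_Icc (a := (0 : ℝ)) (b := t)).exists_bound_of_continuousOn
    (hy.continuousOn.mono fun s hs => hs.1)
  have hB0 : 0 ≤ B := (norm_nonneg _).trans (hB 0 ⟨le_rfl, ht⟩)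
  obtain ⟨M, hM0, hM⟩ : ∃ M : ℝ, 0 < M ∧ ∀ i, ‖A i‖ ≤ M :=
    ⟨∑ i, ‖A i‖ + 1, by positivity, fun i =>
      (Finset.single_le_sum (f := fun i => ‖A i‖) (fun _ _ => norm_nonneg _)
        (Finset.mem_univ i)).trans (by linarith)⟩
  -- Only steps with a point of `F` in their interior produce an error, each at most the Grönwall
  -- term with forcing `2 * M * B`. A jump at a grid point costs nothing, the mode being frozen at
  -- the left end of a step.
  have hit : ∀ (h : ℝ) (k : ℕ), 0 ≤ h → k * h ≤ t → ‖y (k * h) - frozenFlow A ρ h k *ᵥ v‖ ≤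
      Real.exp (M * (k * h)) * (((Finset.range k).filter fun j : ℕ =>
        ∃ f ∈ F, f ∈ Ioo (j * h) ((j + 1) * h)).card * gronwallBound 0 M (2 * M * B) h) := by
    intro h k hh
    have hD : 0 ≤ gronwallBound 0 M (2 * M * B) h := by
      have := gronwallBound_mono le_rfl (by positivity : 0 ≤ 2 * M * B) hM0.le hh
      rwa [gronwallBound_x0] at this
    induction k with
    | zero => intro _; simp [frozenFlow, hy.initial]
    | succ k ih =>
      intro hk
      push_cast at hk ⊢
      have hk' : (k : ℝ) * h ≤ t := by nlinarith
      have hstep : ‖y ((k + 1) * h) - exp (h • A (ρ (k * h))) *ᵥ y (k * h)‖ ≤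
          (if ∃ f ∈ F, f ∈ Ioo (k * h) ((k + 1) * h) then 1 else 0) *
            gronwallBound 0 M (2 * M * B) h := by
        have key := fun ε => hy.norm_sub_exp_le (a := k * h) (b := (k + 1) * h) (M := M) (ε := ε)
          (by positivity) (by nlinarith) hM
        rw [show (k + 1) * h - k * h = h by ring] at key
        split_ifs with hf
        · rw [one_mul]
          refine key _ fun s hs => (Matrix.linfty_opNorm_mulVec _ _).trans ?_
          refine mul_le_mul ((norm_sub_le _ _).trans ?_)
            (hB s ⟨le_trans (by positivity) hs.1, hs.2.le.trans hk⟩) (norm_nonneg _) (by positivity)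
          linarith [hM (ρ s), hM (ρ (k * h))]
        · rw [zero_mul, ← gronwallBound_ε0_δ0 M h]
          push Not at hf
          refine key _ fun s hs => ?_
          rw [hF _ _ (by positivity) hk hf s hs]
          simp
      rw [frozenFlow, ← Matrix.mulVec_mulVec, Finset.range_add_one, Finset.filter_insert]
      have htri : ‖y ((k + 1) * h) -
          exp (h • A (ρ (k * h))) *ᵥ (frozenFlow A ρ h k *ᵥ v)‖ ≤
          ‖y ((k + 1) * h) - exp (h • A (ρ (k * h))) *ᵥ y (k * h)‖ +
          ‖y (k * h) - frozenFlow A ρ h k *ᵥ v‖ * Real.exp (M * h) := by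
        refine (norm_sub_le_norm_sub_add_norm_sub _ (exp (h • A (ρ (k * h))) *ᵥ y (k * h)) _).trans ?_
        rw [← Matrix.mulVec_sub]
        gcongr
        exact norm_exp_smul_mulVec_le (hM _) hh _
      refine htri.trans ?_
      have hexp : Real.exp (M * ((k + 1) * h)) = Real.exp (M * (k * h)) * Real.exp (M * h) := by
        rw [← Real.exp_add]; ring_nf
      have hexp1 : 1 ≤ Real.exp (M * ((k + 1) * h)) := Real.one_le_exp (by positivity)
      have h2 := mul_le_mul_of_nonneg_right (ih hk') (Real.exp_pos (M * h)).le
      split_ifs at hstep ⊢ with hf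
      · rw [Finset.card_insert_of_notMem (by simp)]
        push_cast
        rw [one_mul] at hstep
        have h3 := mul_le_mul_of_nonneg_right hexp1 hD
        rw [hexp] at h3 ⊢
        linarith
      · rw [zero_mul] at hstep
        rw [hexp]
        linarith
  -- The interiors of the steps are disjoint, so choosing a point of `F` in each bad one is
  -- injective.
  have hcard : ∀ (h : ℝ) (k : ℕ), 0 ≤ h → ((Finset.range k).filter fun j : ℕ =>
        ∃ f ∈ F, f ∈ Ioo (j * h) ((j + 1) * h)).card ≤ F.card := by
    intro h k hh
    choose! g hgF hg using fun (j : ℕ) (hj : ∃ f ∈ F, f ∈ Ioo (j * h) ((j + 1) * h)) => hj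
    have hlt : ∀ i j : ℕ, i < j → g i ∈ Ioo (i * h) ((i + 1) * h) →
        g j ∈ Ioo (j * h) ((j + 1) * h) → g i < g j := by
      intro i j hij hi hj
      have : ((i : ℝ) + 1) * h ≤ j * h := by gcongr; exact_mod_cast hij
      exact hi.2.trans (this.trans_lt hj.1)
    refine Finset.card_le_card_of_injOn g (fun j hj => hgF j (Finset.mem_filter.1 hj).2) ?_
    intro i hi j hj hij
    have hi := hg i (Finset.mem_filter.1 hi).2
    have hj := hg j (Finset.mem_filter.1 hj).2
    by_contra hne
    rcases lt_or_gt_of_ne hne with h | h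
    · exact (hlt i j h hi hj).ne hij
    · exact (hlt j i h hj hi).ne hij.symm
  have hlim : Tendsto (fun k : ℕ => Real.exp (M * t) *
      (F.card * gronwallBound 0 M (2 * M * B) (t / k))) atTop (𝓝 0) := by
    have hc : Continuous (gronwallBound 0 M (2 * M * B)) :=
      continuous_iff_continuousAt.2 fun u => (hasDerivAt_gronwallBound _ _ _ u).continuousAt
    have := (hc.tendsto 0).comp (tendsto_const_div_atTop_nhds_zero_nat t)
    rw [gronwallBound_x0] at this
    simpa using (this.const_mul (F.card : ℝ)).const_mul (Real.exp (M * t))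
  rw [tendsto_iff_norm_sub_tendsto_zero]
  refine squeeze_zero' (Eventually.of_forall fun _ => norm_nonneg _) ?_ hlim
  filter_upwards [eventually_gt_atTop 0] with k hk
  have hk0 : (k : ℝ) ≠ 0 := by positivity
  have hkt : k * (t / k) = t := mul_div_cancel₀ _ hk0
  have h0 : 0 ≤ t / k := by positivity
  have := hit (t / k) k h0 hkt.le
  rw [hkt] at this
  rw [norm_sub_rev]
  refine this.trans ?_
  have hD : 0 ≤ gronwallBound 0 M (2 * M * B) (t / k) := by
    have := gronwallBound_mono le_rfl (by positivity : 0 ≤ 2 * M * B) hM0.le h0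
    rwa [gronwallBound_x0] at this
  have hc : ((((Finset.range k).filter fun j : ℕ =>
        ∃ f ∈ F, f ∈ Ioo (j * (t / k)) ((j + 1) * (t / k))).card : ℕ) : ℝ) ≤ F.card :=
    Nat.cast_le.2 (hcard (t / k) k h0)
  gcongr

end Flow

/-! ### Evolution of the moments. -/

section Markov

open scoped Matrix.Norms.Operator
open NormedSpace (exp)

variable {Ω : Type*} [MeasurableSpace Ω] {P : Measure Ω} {n N : ℕ}
  {Q : Matrix (Fin N) (Fin N) ℝ} {r : ℝ → Ω → Fin N}

theorem IsMarkovProcess.history_le (hr : IsMarkovProcess P Q r) (s : ℝ) :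
    history r s ≤ ‹MeasurableSpace Ω› :=
  iSup₂_le fun u hu => (hr.measurable u hu.1).comap_le

omit [MeasurableSpace Ω] in
theorem measurable_history {u s : ℝ} (hu : u ∈ Icc 0 s) : Measurable[history r s] (r u) :=
  Measurable.of_comap_le (le_iSup₂_of_le u hu le_rfl)

/-- The transition probabilities of a Markov process, continued to the states that it does not
visit by their first-order expansion. -/
theorem IsMarkovProcess.exists_transition [IsProbabilityMeasure P] (hr : IsMarkovProcess P Q r) :
    ∃ p : ℝ → Matrix (Fin N) (Fin N) ℝ, p 0 = 1 ∧
      (∀ i j, HasDerivWithinAt (fun h => p h i j) (Q i j) (Ioi 0) 0) ∧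
      ∀ s h, 0 ≤ s → 0 ≤ h → ∀ i j, P (r s ⁻¹' {i}) ≠ 0 →
        p h i j = (P[r (s + h) ⁻¹' {j} | r s ⁻¹' {i}]).toReal := by
  classical
  have H : ∀ i j, ∃ p : ℝ → ℝ, p 0 = (1 : Matrix (Fin N) (Fin N) ℝ) i j ∧
      HasDerivWithinAt p (Q i j) (Ioi 0) 0 ∧
      ∀ s h, 0 ≤ s → 0 ≤ h → P (r s ⁻¹' {i}) ≠ 0 →
        p h = (P[r (s + h) ⁻¹' {j} | r s ⁻¹' {i}]).toReal := by
    intro i j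
    by_cases hi : ∃ s, 0 ≤ s ∧ P (r s ⁻¹' {i}) ≠ 0
    · obtain ⟨s, hs, hi⟩ := hi
      have h0 : (P[r (s + 0) ⁻¹' {j} | r s ⁻¹' {i}]).toReal =
          (1 : Matrix (Fin N) (Fin N) ℝ) i j := by
        have hm : MeasurableSet (r s ⁻¹' {i}) := hr.measurable s hs (measurableSet_singleton i)
        rw [add_zero, cond_apply hm, Matrix.one_apply]
        split_ifs with hij
        · rw [← hij, inter_self, ENNReal.inv_mul_cancel hi (measure_ne_top _ _), ENNReal.toReal_one]
        · have : r s ⁻¹' {i} ∩ r s ⁻¹' {j} = ∅ := by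
            ext ω
            simp only [mem_inter_iff, mem_preimage, mem_singleton_iff, mem_empty_iff_false,
              iff_false, not_and]
            intro h1 h2
            exact hij (h1.symm.trans h2)
          simp [this]
      refine ⟨fun h => (P[r (s + h) ⁻¹' {j} | r s ⁻¹' {i}]).toReal, h0, ?_, ?_⟩
      · rw [hasDerivWithinAt_iff_isLittleO]
        refine (hr.rate s hs i j hi).congr_left ?_ |>.trans_isBigO ?_
        · intro h
          rw [h0, Matrix.one_apply, sub_zero, smul_eq_mul]
          ring
        · simpa using isBigO_refl _ _
      · intro s' h hs' hh hi'
        simp only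
        rw [hr.homogeneous s s' h hs hs' hh i j hi hi']
    -- The values for an unvisited state multiply integrals over null sets, but their derivative
    -- must be `Q i j` for `stepMatrix` to have the right derivative.
    · push Not at hi
      refine ⟨fun h => (1 : Matrix (Fin N) (Fin N) ℝ) i j + Q i j * h, by simp, ?_,
        fun s h hs _ h' => absurd (hi s hs) h'⟩
      simpa using (((hasDerivAt_id (0 : ℝ)).const_mul (Q i j)).const_add
        ((1 : Matrix (Fin N) (Fin N) ℝ) i j)).hasDerivWithinAt (s := Ioi 0)
  choose p hp using H
  exact ⟨fun h => Matrix.of fun i j => p i j h, by ext i j; exact (hp i j).1,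
    fun i j => (hp i j).2.1, fun s h hs hh i j => (hp i j).2.2 s h hs hh⟩

/-- The Markov property for functions of the history. -/
theorem IsMarkovProcess.setIntegral_eq [IsProbabilityMeasure P] (hr : IsMarkovProcess P Q r)
    {s h : ℝ} (hs : 0 ≤ s) (hh : 0 ≤ h) (i j : Fin N) {c : ℝ}
    (hc : P (r s ⁻¹' {i}) ≠ 0 → c = (P[r (s + h) ⁻¹' {j} | r s ⁻¹' {i}]).toReal)
    {f : Ω → ℝ} (hf : Measurable[history r s] f) :
    ∫ ω in r s ⁻¹' {i} ∩ r (s + h) ⁻¹' {j}, f ω ∂P = c * ∫ ω in r s ⁻¹' {i}, f ω ∂P := by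
  by_cases hi : P (r s ⁻¹' {i}) = 0
  · rw [setIntegral_measure_zero _ hi,
      setIntegral_measure_zero _ (measure_mono_null inter_subset_left hi), mul_zero]
  have hle := hr.history_le s
  have hmi : MeasurableSet[history r s] (r s ⁻¹' {i}) :=
    measurable_history ⟨hs, le_rfl⟩ (measurableSet_singleton i)
  have hmj : MeasurableSet (r (s + h) ⁻¹' {j}) :=
    hr.measurable _ (add_nonneg hs hh) (measurableSet_singleton j)
  have hc0 : 0 ≤ c := by rw [hc hi]; exact ENNReal.toReal_nonneg
  have hc' : ENNReal.ofReal c = P[r (s + h) ⁻¹' {j} | r s ⁻¹' {i}] := by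
    rw [hc hi, ENNReal.ofReal_toReal (measure_ne_top _ _)]
  -- The Markov property says that two measures agree on the history; integrals of
  -- history-measurable functions then agree.
  have hμ : (P.restrict (r s ⁻¹' {i} ∩ r (s + h) ⁻¹' {j})).trim hle =
      (ENNReal.ofReal c • P.restrict (r s ⁻¹' {i})).trim hle := by
    refine @Measure.ext _ (history r s) _ _ fun B hB => ?_
    rw [trim_measurableSet_eq hle hB, trim_measurableSet_eq hle hB, Measure.smul_apply,
      Measure.restrict_apply (hle _ hB), Measure.restrict_apply (hle _ hB), smul_eq_mul]
    have e1 : B ∩ (r s ⁻¹' {i} ∩ r (s + h) ⁻¹' {j}) =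
        (r s ⁻¹' {i} ∩ B) ∩ r (s + h) ⁻¹' {j} := by
      rw [← inter_assoc, inter_comm B]
    rw [e1, inter_comm B]
    by_cases hB0 : P (r s ⁻¹' {i} ∩ B) = 0
    · rw [hB0, mul_zero, measure_mono_null inter_subset_left hB0]
    rw [hc', ← hr.markov s h hs hh i j B hB hB0,
      cond_mul_eq_inter (hle _ (hmi.inter hB)) _ P]
  rw [integral_trim hle hf.stronglyMeasurable, hμ, ← integral_trim hle hf.stronglyMeasurable,
    integral_smul_measure, ENNReal.toReal_ofReal hc0, smul_eq_mul]

/-- Only the modes at times `j * h` with `j < k` enter, so this also applies with the σ-algebra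
`history r (k * h)`. -/
theorem measurable_frozenFlow (A : Fin N → Matrix (Fin n) (Fin n) ℝ) (h : ℝ) {k : ℕ}
    (hm : ∀ j : ℕ, j < k → Measurable (r (j * h))) (i j : Fin n) :
    Measurable fun ω => frozenFlow A (fun t => r t ω) h k i j := by
  induction k generalizing i j with
  | zero => simp [frozenFlow]
  | succ k ih =>
    simp only [frozenFlow, Matrix.mul_apply]
    refine Finset.measurable_fun_sum _ fun p _ => Measurable.mul ?_
      (ih (fun j hj => hm j (hj.trans k.lt_succ_self)) p j)
    exact (measurable_of_countable fun a => exp (h • A a) i p).comp (hm k k.lt_succ_self)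

theorem continuous_powerVec (m : ℕ) : Continuous (powerVec m : (Fin n → ℝ) → _) := by
  refine continuous_pi fun s => continuous_const.mul ?_
  simp only [Finset.prod_multiset_map_count]
  fun_prop

theorem measurable_frozenFlow_mulVec (A : Fin N → Matrix (Fin n) (Fin n) ℝ) (h : ℝ) {k : ℕ}
    (hm : ∀ j : ℕ, j < k → Measurable (r (j * h))) (v : Fin n → ℝ) :
    Measurable fun ω => frozenFlow A (fun t => r t ω) h k *ᵥ v :=
  measurable_pi_iff.2 fun i => by
    simp only [Matrix.mulVec, dotProduct]
    exact Finset.measurable_fun_sum _ fun j _ => (measurable_frozenFlow A h hm i j).mul_const _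

theorem exists_norm_powerVec_le (m : ℕ) (R : ℝ) :
    ∃ C, ∀ x : Fin n → ℝ, ‖x‖ ≤ R → ‖powerVec m x‖ ≤ C := by
  obtain ⟨C, hC⟩ := (isCompact_closedBall (0 : Fin n → ℝ) R).exists_bound_of_continuousOn
    (continuous_powerVec m).continuousOn
  exact ⟨C, fun x hx => hC x (by simpa using hx)⟩

theorem exists_norm_le (A : Fin N → Matrix (Fin n) (Fin n) ℝ) : ∃ M : ℝ, ∀ i, ‖A i‖ ≤ M :=
  ⟨∑ i, ‖A i‖, fun i => Finset.single_le_sum (f := fun i => ‖A i‖) (fun _ _ => norm_nonneg _)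
    (Finset.mem_univ i)⟩

/-- The one-step matrix of the moments `E[1_{r(t) = i} x(t)^[m]]` of the frozen flow. -/
def stepMatrix (m : ℕ) (A : Fin N → Matrix (Fin n) (Fin n) ℝ) (p : ℝ → Matrix (Fin N) (Fin N) ℝ)
    (h : ℝ) : Matrix (Fin N × Sym (Fin n) m) (Fin N × Sym (Fin n) m) ℝ :=
  Matrix.of fun a b => p h b.1 a.1 * exp (h • lowerPower m (A b.1)) a.2 b.2

theorem stepMatrix_zero (m : ℕ) (A : Fin N → Matrix (Fin n) (Fin n) ℝ)
    {p : ℝ → Matrix (Fin N) (Fin N) ℝ} (hp : p 0 = 1) : stepMatrix m A p 0 = 1 := by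
  ext ⟨i, σ⟩ ⟨j, τ⟩
  simp only [stepMatrix, hp, zero_smul, NormedSpace.exp_zero, Matrix.of_apply, Matrix.one_apply,
    Prod.mk.injEq]
  split_ifs <;> simp_all

/-- Product rule: as both factors are identities at `h = 0`, the transition probabilities contribute
`Qᵀ ⊗ I` and the flows the block diagonal. -/
theorem hasDerivWithinAt_stepMatrix (m : ℕ) (A : Fin N → Matrix (Fin n) (Fin n) ℝ)
    {p : ℝ → Matrix (Fin N) (Fin N) ℝ} (hp : p 0 = 1)
    (hp' : ∀ i j, HasDerivWithinAt (fun h => p h i j) (Q i j) (Ioi 0) 0) :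
    HasDerivWithinAt (stepMatrix m A p) (meanMatrix m A Q) (Ioi 0) 0 := by
  refine hasDerivWithinAt_pi.2 fun a => hasDerivWithinAt_pi.2 fun b => ?_
  have h1 : HasDerivAt (fun h : ℝ => exp (h • lowerPower m (A b.1)) a.2 b.2)
      (lowerPower m (A b.1) a.2 b.2) 0 := by
    have := hasDerivAt_exp_smul (lowerPower m (A b.1)) 0
    rw [zero_smul, NormedSpace.exp_zero, mul_one] at this
    exact hasDerivAt_pi.1 (hasDerivAt_pi.1 this a.2) b.2
  refine ((hp' b.1 a.1).mul h1.hasDerivWithinAt).congr_deriv ?_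
  rw [hp, zero_smul, NormedSpace.exp_zero]
  simp only [meanMatrix, Matrix.add_apply, Matrix.kroneckerMap_apply, Matrix.transpose_apply,
    Matrix.submatrix_apply, Matrix.blockDiagonal_apply, Prod.swap, Matrix.one_apply, eq_comm]
  by_cases hab : a.1 = b.1 <;> simp [hab]

variable [IsProbabilityMeasure P]

theorem integrable_powerVec_frozenFlow (hr : IsMarkovProcess P Q r) (m : ℕ)
    (A : Fin N → Matrix (Fin n) (Fin n) ℝ) {h : ℝ} (hh : 0 ≤ h) (k : ℕ) (v : Fin n → ℝ)
    (σ : Sym (Fin n) m) :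
    Integrable (fun ω => powerVec m (frozenFlow A (fun t => r t ω) h k *ᵥ v) σ) P := by
  obtain ⟨M, hM⟩ := exists_norm_le A
  obtain ⟨C, hC⟩ := exists_norm_powerVec_le (n := n) m (‖v‖ * Real.exp (M * (k * h)))
  refine Integrable.of_bound ?_ C (ae_of_all _ fun ω =>
    (norm_le_pi_norm _ σ).trans (hC _ (norm_frozenFlow_mulVec_le hM _ hh v k)))
  exact (((continuous_apply σ).comp (continuous_powerVec m)).measurable.comp
    (measurable_frozenFlow_mulVec A h (fun j _ => hr.measurable _ (by positivity))
      v)).aestronglyMeasurable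

/-- The moments of the frozen flow follow the powers of the one-step matrix. -/
theorem moment_frozenFlow (hr : IsMarkovProcess P Q r) {p : ℝ → Matrix (Fin N) (Fin N) ℝ}
    (hp : ∀ s h, 0 ≤ s → 0 ≤ h → ∀ i j, P (r s ⁻¹' {i}) ≠ 0 →
        p h i j = (P[r (s + h) ⁻¹' {j} | r s ⁻¹' {i}]).toReal)
    {r₀ : Fin N} (hr0 : ∀ᵐ ω ∂P, r 0 ω = r₀) (m : ℕ) (A : Fin N → Matrix (Fin n) (Fin n) ℝ)
    {h : ℝ} (hh : 0 ≤ h) (k : ℕ) (v : Fin n → ℝ) :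
    (fun a : Fin N × Sym (Fin n) m => ∫ ω in r (k * h) ⁻¹' {a.1},
      powerVec m (frozenFlow A (fun t => r t ω) h k *ᵥ v) a.2 ∂P) =
    stepMatrix m A p h ^ k *ᵥ fun a => if a.1 = r₀ then powerVec m v a.2 else 0 := by
  induction k with
  | zero =>
    ext ⟨i, σ⟩
    simp only [Nat.cast_zero, zero_mul, frozenFlow, Matrix.one_mulVec, pow_zero, setIntegral_const,
      smul_eq_mul]
    split_ifs with hi
    · have : P (r 0 ⁻¹' {i}) = 1 := by
        rw [prob_compl_eq_zero_iff₀
          (hr.measurable 0 le_rfl (measurableSet_singleton i)).nullMeasurableSet |>.symm]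
        rw [hi]
        exact hr0
      simp [Measure.real, this]
    · have : P (r 0 ⁻¹' {i}) = 0 := by
        refine measure_mono_null (fun ω hω => ?_) hr0
        intro h'
        exact hi (hω.symm.trans h')
      simp [Measure.real, this]
  | succ k ih =>
    rw [pow_succ', ← Matrix.mulVec_mulVec, ← ih]
    ext ⟨j, σ⟩
    have hk0 : 0 ≤ k * h := by positivity
    have hk1 : ((k + 1 : ℕ) : ℝ) * h = k * h + h := by push_cast; ring
    have hmi : ∀ i, MeasurableSet (r (k * h) ⁻¹' {i}) := fun i =>
      hr.measurable _ hk0 (measurableSet_singleton i)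
    have hmj : MeasurableSet (r (k * h + h) ⁻¹' {j}) :=
      hr.measurable _ (add_nonneg hk0 hh) (measurableSet_singleton j)
    simp only [hk1, Matrix.mulVec, dotProduct, Fintype.sum_prod_type, stepMatrix, Matrix.of_apply]
    have hpart : r (k * h + h) ⁻¹' {j} =
        ⋃ i, (r (k * h) ⁻¹' {i} ∩ r (k * h + h) ⁻¹' {j}) := by
      rw [← iUnion_inter, ← preimage_iUnion, iUnion_of_singleton, preimage_univ, univ_inter]
    have hint := fun (k : ℕ) (σ : Sym (Fin n) m) => integrable_powerVec_frozenFlow hr m A hh k v σ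
    rw [hpart, integral_iUnion_fintype (fun i => (hmi i).inter hmj) ?_
      fun i => (hint (k + 1) σ).integrableOn]
    · refine Finset.sum_congr rfl fun i _ => ?_
      -- On `r (k * h) = i` the new factor is the deterministic `exp (h A_i)`; what remains depends
      -- on the history, so the Markov property splits off the transition probability.
      have hcongr : ∫ ω in r (k * h) ⁻¹' {i} ∩ r (k * h + h) ⁻¹' {j},
          powerVec m (frozenFlow A (fun t => r t ω) h (k + 1) *ᵥ v) σ ∂P =
          ∫ ω in r (k * h) ⁻¹' {i} ∩ r (k * h + h) ⁻¹' {j},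
          ∑ τ, exp (h • lowerPower m (A i)) σ τ *
            powerVec m (frozenFlow A (fun t => r t ω) h k *ᵥ v) τ ∂P := by
        refine setIntegral_congr_fun ((hmi i).inter hmj) fun ω hω => ?_
        have hω : r (k * h) ω = i := hω.1
        simp only [frozenFlow, hω]
        rw [← Matrix.mulVec_mulVec, powerVec_exp]
        rfl
      rw [hcongr, hr.setIntegral_eq hk0 hh i j (hp _ _ hk0 hh i j), integral_finsetSum _
        fun τ _ => ((hint k τ).const_mul _).integrableOn, Finset.mul_sum]
      · refine Finset.sum_congr rfl fun τ _ => ?_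
        rw [integral_const_mul, mul_assoc]
      · refine Finset.measurable_fun_sum _ fun τ _ => Measurable.const_mul ?_ _
        refine ((continuous_apply τ).comp (continuous_powerVec m)).measurable.comp
          (@measurable_frozenFlow_mulVec _ (history r (k * h)) _ _ _ A h k (fun l hl => ?_) v)
        exact measurable_history ⟨by positivity, by gcongr⟩
    · intro i i' hne
      refine disjoint_left.2 fun ω h1 h2 => hne ?_
      exact h1.1.symm.trans h2.1

/-- The moments `E[1_{r(t) = i} x(t)^[m]]` are given by the exponential of the mean matrix. -/
theorem moment_eq (hr : IsMarkovProcess P Q r) {r₀ : Fin N} (hr0 : ∀ᵐ ω ∂P, r 0 ω = r₀) (m : ℕ)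
    {A : Fin N → Matrix (Fin n) (Fin n) ℝ} {v : Fin n → ℝ} {x : ℝ → Ω → Fin n → ℝ}
    (hx : ∀ᵐ ω ∂P, IsSolution A (fun t => r t ω) v fun t => x t ω) {t : ℝ} (ht : 0 ≤ t) :
    (fun a : Fin N × Sym (Fin n) m => ∫ ω in r t ⁻¹' {a.1}, powerVec m (x t ω) a.2 ∂P) =
      exp (t • meanMatrix m A Q) *ᵥ fun a => if a.1 = r₀ then powerVec m v a.2 else 0 := by
  obtain ⟨p, hp0, hp', hp⟩ := hr.exists_transition
  obtain ⟨M, hM⟩ := exists_norm_le A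
  obtain ⟨C, hC⟩ := exists_norm_powerVec_le (n := n) m (‖v‖ * Real.exp (M * t))
  have hG := tendsto_pow_exp (stepMatrix_zero m A hp0) (hasDerivWithinAt_stepMatrix m A hp0 hp') ht
  have h1 := (((continuous_id.matrix_mulVec continuous_const).tendsto _).comp hG :
    Tendsto (fun k : ℕ => stepMatrix m A p (t / k) ^ k *ᵥ
      fun a => if a.1 = r₀ then powerVec m v a.2 else 0) atTop (𝓝 _))
  -- Both sides are limits of the moments of the frozen flows.
  refine tendsto_nhds_unique (tendsto_pi_nhds.2 fun a => ?_) h1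
  have h2 : Tendsto (fun k : ℕ => ∫ ω in r t ⁻¹' {a.1},
      powerVec m (frozenFlow A (fun t => r t ω) (t / k) k *ᵥ v) a.2 ∂P) atTop
      (𝓝 (∫ ω in r t ⁻¹' {a.1}, powerVec m (x t ω) a.2 ∂P)) := by
    refine tendsto_integral_filter_of_dominated_convergence (fun _ => C) ?_ ?_
      (integrable_const C) ?_
    · exact Eventually.of_forall fun k =>
        (integrable_powerVec_frozenFlow hr m A (by positivity) k v a.2).aestronglyMeasurable.restrict
    · filter_upwards [eventually_gt_atTop 0] with k hk
      refine ae_of_all _ fun ω => (norm_le_pi_norm _ a.2).trans (hC _ ?_)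
      have := norm_frozenFlow_mulVec_le hM (fun t => r t ω) (by positivity : 0 ≤ t / k) v k
      rwa [mul_div_cancel₀ _ (by positivity)] at this
    · filter_upwards [ae_restrict_of_ae hx, ae_restrict_of_ae hr.cadlag] with ω h1 h2
      exact ((((continuous_apply a.2).comp (continuous_powerVec m)).tendsto _).comp
        (h1.tendsto_frozenFlow h2.1 h2.2 ht))
  refine h2.congr' ?_
  filter_upwards [eventually_gt_atTop 0] with k hk
  have := congrFun (moment_frozenFlow hr hp hr0 m A (by positivity : 0 ≤ t / k) k v) a
  rwa [mul_div_cancel₀ _ (by positivity)] at this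

omit [IsProbabilityMeasure P] in
-- Solutions are given path by path; measurability in `ω` comes from the frozen flows that
-- approximate them.
theorem aestronglyMeasurable_of_isSolution (hr : IsMarkovProcess P Q r)
    {A : Fin N → Matrix (Fin n) (Fin n) ℝ} {v : Fin n → ℝ} {x : ℝ → Ω → Fin n → ℝ}
    (hx : ∀ᵐ ω ∂P, IsSolution A (fun t => r t ω) v fun t => x t ω) {t : ℝ} (ht : 0 ≤ t) :
    AEStronglyMeasurable (x t) P := by
  refine aestronglyMeasurable_of_tendsto_ae atTop
    (f := fun (k : ℕ) ω => frozenFlow A (fun t => r t ω) (t / k) k *ᵥ v) (fun k => ?_) ?_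
  · exact (measurable_frozenFlow_mulVec A _ (fun j _ => hr.measurable _ (by positivity))
      v).aestronglyMeasurable
  · filter_upwards [hx, hr.cadlag] with ω h1 h2
    exact h1.tendsto_frozenFlow h2.1 h2.2 ht

omit [IsProbabilityMeasure P] in
theorem ae_norm_le_of_isSolution (hr : IsMarkovProcess P Q r)
    {A : Fin N → Matrix (Fin n) (Fin n) ℝ} {v : Fin n → ℝ} {x : ℝ → Ω → Fin n → ℝ}
    (hx : ∀ᵐ ω ∂P, IsSolution A (fun t => r t ω) v fun t => x t ω) {t : ℝ} (ht : 0 ≤ t) :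
    ∃ R, ∀ᵐ ω ∂P, ‖x t ω‖ ≤ R := by
  obtain ⟨M, hM⟩ := exists_norm_le A
  refine ⟨‖v‖ * Real.exp (M * t), ?_⟩
  filter_upwards [hx, hr.cadlag] with ω h1 h2
  refine le_of_tendsto (h1.tendsto_frozenFlow h2.1 h2.2 ht).norm ?_
  filter_upwards [eventually_gt_atTop 0] with k hk
  have := norm_frozenFlow_mulVec_le hM (fun t => r t ω) (by positivity : 0 ≤ t / k) v k
  rwa [mul_div_cancel₀ _ (by positivity)] at this

end Markov

/-! ### From moments to mean stability and back. -/

section MeanStability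

open scoped Matrix.Norms.Operator
open NormedSpace (exp)

variable {Ω : Type*} [MeasurableSpace Ω] {P : Measure Ω} {n N : ℕ}
  {Q : Matrix (Fin N) (Fin N) ℝ} {r : ℝ → Ω → Fin N} {A : Fin N → Matrix (Fin n) (Fin n) ℝ}
  {v : Fin n → ℝ} {x : ℝ → Ω → Fin n → ℝ}

/-- For Metzler matrices, the solution started at `|v|` dominates the one started at `v`. -/
theorem IsSolution.abs_le {ρ : ℝ → Fin N} {y z : ℝ → Fin n → ℝ} (hA : ∀ i, IsMetzler (A i))
    (hy : IsSolution A ρ v y) (hz : IsSolution A ρ (fun i => |v i|) z)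
    (hright : ∀ t, 0 ≤ t → ∀ᶠ u in 𝓝[>] t, ρ u = ρ t)
    (hleft : ∀ t, 0 < t → ∃ j, ∀ᶠ u in 𝓝[<] t, ρ u = j) {t : ℝ} (ht : 0 ≤ t) (i : Fin n) :
    |y t i| ≤ z t i := by
  have h1 := (tendsto_pi_nhds.1 (hy.tendsto_frozenFlow hright hleft ht) i).abs
  have h2 := tendsto_pi_nhds.1 (hz.tendsto_frozenFlow hright hleft ht) i
  -- The frozen flows are entrywise nonnegative, so `|F v| ≤ F |v|`, and this passes to the limit.
  refine le_of_tendsto_of_tendsto' h1 h2 fun k => ?_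
  simp only [Matrix.mulVec, dotProduct]
  refine (Finset.abs_sum_le_sum_abs _ _).trans (Finset.sum_le_sum fun j _ => ?_)
  rw [abs_mul, abs_of_nonneg (frozenFlow_nonneg hA ρ (by positivity) k i j)]

theorem norm_powerVec_apply_le (m : ℕ) (y : Fin n → ℝ) (σ : Sym (Fin n) m) :
    ‖powerVec m y σ‖ ≤ ‖WithLp.toLp 2 y‖ ^ m := by
  rw [← norm_powerVec]
  exact PiLp.norm_apply_le (WithLp.toLp 2 (powerVec m y)) σ

/-- The Euclidean norm of `y^[m]` is at most its `ℓ¹` norm, which for nonnegative entries is a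
linear form in `y^[m]`, hence controlled by the moments. -/
theorem norm_pow_le_sum_powerVec (m : ℕ) {y : Fin n → ℝ} (hy : ∀ i, 0 ≤ y i) :
    ‖WithLp.toLp 2 y‖ ^ m ≤ ∑ σ, powerVec m y σ := by
  have h0 : ∀ σ, 0 ≤ powerVec m y σ := fun σ =>
    mul_nonneg (Real.sqrt_nonneg _) (Multiset.prod_nonneg fun a ha => by
      obtain ⟨i, -, rfl⟩ := Multiset.mem_map.1 ha
      exact hy i)
  rw [← norm_powerVec, EuclideanSpace.norm_eq]
  refine Real.sqrt_le_iff.2 ⟨Finset.sum_nonneg fun σ _ => h0 σ, ?_⟩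
  simp only [Real.norm_eq_abs, sq_abs]
  exact Finset.sum_sq_le_sq_sum_of_nonneg fun σ _ => h0 σ

theorem norm_toLp_le_of_abs_le {y z : Fin n → ℝ} (h : ∀ i, |y i| ≤ z i) :
    ‖WithLp.toLp 2 y‖ ≤ ‖WithLp.toLp 2 z‖ := by
  rw [EuclideanSpace.norm_eq, EuclideanSpace.norm_eq]
  refine Real.sqrt_le_sqrt (Finset.sum_le_sum fun i _ => ?_)
  simp only [Real.norm_eq_abs, sq_abs]
  exact sq_le_sq.2 ((h i).trans (le_abs_self _))

theorem integrable_comp_of_isSolution [IsFiniteMeasure P] (hr : IsMarkovProcess P Q r)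
    (hx : ∀ᵐ ω ∂P, IsSolution A (fun t => r t ω) v fun t => x t ω) {t : ℝ} (ht : 0 ≤ t)
    {g : (Fin n → ℝ) → ℝ} (hg : Continuous g) : Integrable (fun ω => g (x t ω)) P := by
  obtain ⟨R, hR⟩ := ae_norm_le_of_isSolution hr hx ht
  obtain ⟨C, hC⟩ := (isCompact_closedBall (0 : Fin n → ℝ) R).exists_bound_of_continuousOn
    hg.continuousOn
  refine Integrable.of_bound
    (hg.comp_aestronglyMeasurable (aestronglyMeasurable_of_isSolution hr hx ht)) C ?_
  filter_upwards [hR] with ω hω using hC _ (by simpa using hω)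

theorem continuous_norm_toLp_pow (m : ℕ) :
    Continuous fun y : Fin n → ℝ => ‖WithLp.toLp 2 y‖ ^ m :=
  ((PiLp.continuous_toLp 2 _).norm).pow m

theorem continuous_powerVec_apply (m : ℕ) (σ : Sym (Fin n) m) :
    Continuous fun y : Fin n → ℝ => powerVec m y σ :=
  (continuous_apply σ).comp (continuous_powerVec m)

variable [IsProbabilityMeasure P]

/-- The `m`-th mean of the solution is bounded by the exponential of the mean matrix. -/
theorem integral_norm_pow_le (hA : ∀ i, IsMetzler (A i)) (hr : IsMarkovProcess P Q r)
    {r₀ : Fin N} (hr0 : ∀ᵐ ω ∂P, r 0 ω = r₀) (m : ℕ) {z : ℝ → Ω → Fin n → ℝ}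
    (hx : ∀ᵐ ω ∂P, IsSolution A (fun t => r t ω) v fun t => x t ω)
    (hz : ∀ᵐ ω ∂P, IsSolution A (fun t => r t ω) (fun i => |v i|) fun t => z t ω)
    {t : ℝ} (ht : 0 ≤ t) :
    ∫ ω, ‖WithLp.toLp 2 (x t ω)‖ ^ m ∂P ≤ Fintype.card (Fin N × Sym (Fin n) m) *
      (‖exp (t • meanMatrix m A Q)‖ * ‖WithLp.toLp 2 v‖ ^ m) := by
  have hint := fun σ : Sym (Fin n) m =>
    integrable_comp_of_isSolution hr hz ht (continuous_powerVec_apply m σ)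
  have h1 : ∫ ω, ‖WithLp.toLp 2 (x t ω)‖ ^ m ∂P ≤ ∫ ω, ∑ σ, powerVec m (z t ω) σ ∂P := by
    refine integral_mono_ae (integrable_comp_of_isSolution hr hx ht (continuous_norm_toLp_pow m))
      (integrable_finsetSum _ fun σ _ => hint σ) ?_
    filter_upwards [hx, hz, hr.cadlag] with ω hxω hzω hc
    have habs := fun i => hxω.abs_le hA hzω hc.1 hc.2 ht i
    exact (pow_le_pow_left₀ (norm_nonneg _) (norm_toLp_le_of_abs_le habs) m).trans
      (norm_pow_le_sum_powerVec m fun i => (abs_nonneg _).trans (habs i))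
  have hmom := moment_eq hr hr0 m hz ht
  set u : Fin N × Sym (Fin n) m → ℝ := fun a => if a.1 = r₀ then powerVec m (fun i => |v i|) a.2
    else 0 with hu
  have h2 : ∫ ω, ∑ σ, powerVec m (z t ω) σ ∂P = ∑ a, (exp (t • meanMatrix m A Q) *ᵥ u) a := by
    -- Summing over the modes removes the indicator from the moments.
    rw [← hmom, integral_finsetSum _ fun σ _ => hint σ, Fintype.sum_prod_type, Finset.sum_comm]
    refine Finset.sum_congr rfl fun σ _ => ?_
    have huniv : (⋃ i, r t ⁻¹' {i}) = univ := by
      rw [← preimage_iUnion, iUnion_of_singleton, preimage_univ]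
    rw [← setIntegral_univ, ← huniv, integral_iUnion_fintype
      (fun i => hr.measurable t ht (measurableSet_singleton i)) ?_
      fun i => (hint σ).integrableOn]
    intro i i' hne
    exact disjoint_left.2 fun ω h1 h2 => hne (h1.symm.trans h2)
  have hnorm : ‖WithLp.toLp 2 fun i => |v i|‖ = ‖WithLp.toLp 2 v‖ := by
    simp [EuclideanSpace.norm_eq]
  have hu' : ‖u‖ ≤ ‖WithLp.toLp 2 v‖ ^ m := by
    refine (pi_norm_le_iff_of_nonneg (by positivity)).2 fun a => ?_
    simp only [hu]
    split_ifs
    · rw [← hnorm]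
      exact norm_powerVec_apply_le m _ _
    · rw [norm_zero]; positivity
  rw [h2] at h1
  refine h1.trans ((Finset.sum_le_card_nsmul _ _
    (‖exp (t • meanMatrix m A Q)‖ * ‖WithLp.toLp 2 v‖ ^ m) fun a _ => ?_).trans_eq
    (nsmul_eq_mul _ _))
  refine (le_abs_self _).trans ((norm_le_pi_norm (exp (t • meanMatrix m A Q) *ᵥ u) a).trans ?_)
  exact (Matrix.linfty_opNorm_mulVec _ _).trans (by gcongr)

/-- If the `m`-th mean of the solution tends to zero, so do its moments. -/
theorem tendsto_exp_mulVec_of_tendsto (hr : IsMarkovProcess P Q r)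
    {r₀ : Fin N} (hr0 : ∀ᵐ ω ∂P, r 0 ω = r₀) (m : ℕ)
    (hx : ∀ᵐ ω ∂P, IsSolution A (fun t => r t ω) v fun t => x t ω)
    (hlim : Tendsto (fun t => ∫ ω, ‖WithLp.toLp 2 (x t ω)‖ ^ m ∂P) atTop (𝓝 0)) :
    Tendsto (fun t : ℝ => exp (t • meanMatrix m A Q) *ᵥ
      fun a => if a.1 = r₀ then powerVec m v a.2 else 0) atTop (𝓝 0) := by
  refine tendsto_pi_nhds.2 fun a => squeeze_zero_norm' ?_ hlim
  filter_upwards [eventually_ge_atTop 0] with t ht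
  rw [← moment_eq hr hr0 m hx ht]
  have hint := integrable_comp_of_isSolution hr hx ht (continuous_norm_toLp_pow m)
  have hint' := integrable_comp_of_isSolution hr hx ht (continuous_powerVec_apply m a.2)
  calc ‖∫ ω in r t ⁻¹' {a.1}, powerVec m (x t ω) a.2 ∂P‖
      ≤ ∫ ω in r t ⁻¹' {a.1}, ‖powerVec m (x t ω) a.2‖ ∂P := norm_integral_le_integral_norm _
    _ ≤ ∫ ω, ‖powerVec m (x t ω) a.2‖ ∂P :=
        setIntegral_le_integral hint'.norm (ae_of_all _ fun _ => norm_nonneg _)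
    _ ≤ _ := integral_mono hint'.norm hint fun ω => norm_powerVec_apply_le m _ _

theorem exponentiallyMeanStable_of_isHurwitz (hA : ∀ i, IsMetzler (A i))
    {r : Fin N → ℝ → Ω → Fin N} (hr : ∀ r₀, IsMarkovProcess P Q (r r₀))
    (hr0 : ∀ r₀, ∀ᵐ ω ∂P, r r₀ 0 ω = r₀) (m : ℕ)
    {x : Fin N → (Fin n → ℝ) → ℝ → Ω → (Fin n → ℝ)}
    (hx : ∀ r₀ x₀, ∀ᵐ ω ∂P, IsSolution A (fun t => r r₀ t ω) x₀ (fun t => x r₀ x₀ t ω))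
    (hT : IsHurwitz (meanMatrix m A Q)) : ExponentiallyMeanStable P m x := by
  obtain ⟨C, β, hC, hβ, h⟩ := hT.exp_decay
  -- The `+ 1` keeps the constant positive when the index type is empty.
  refine ⟨(Fintype.card (Fin N × Sym (Fin n) m) + 1) * C, β, by positivity, hβ,
    fun r₀ v t ht => ⟨integrable_comp_of_isSolution (hr r₀) (hx r₀ v) ht
      (continuous_norm_toLp_pow m), ?_⟩⟩
  -- The dominating solution is the given trajectory started at `|v|` in the same mode.
  refine (integral_norm_pow_le hA (hr r₀) (hr0 r₀) m (hx r₀ v) (hx r₀ _) ht).trans ?_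
  rw [mul_assoc, mul_assoc, ← mul_assoc C]
  gcongr
  · linarith
  · exact h t ht

end MeanStability

end

theorem theorem5p1 {Ω : Type*} [MeasurableSpace Ω] (P : Measure Ω) [IsProbabilityMeasure P]
    {n N m : ℕ} (hm : 0 < m)
    (A : Fin N → Matrix (Fin n) (Fin n) ℝ) (hA : ∀ i, IsMetzler (A i))
    (Q : Matrix (Fin N) (Fin N) ℝ) (hQ : IsGenerator Q)
    (r : Fin N → ℝ → Ω → Fin N) (hr : ∀ r₀, IsMarkovProcess P Q (r r₀))
    (hr0 : ∀ r₀, ∀ᵐ ω ∂P, r r₀ 0 ω = r₀)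
    (x : Fin N → (Fin n → ℝ) → ℝ → Ω → (Fin n → ℝ))
    (hx : ∀ r₀ x₀, ∀ᵐ ω ∂P,
      IsSolution A (fun t => r r₀ t ω) x₀ (fun t => x r₀ x₀ t ω)) :
    ExponentiallyMeanStable P m x ↔ IsHurwitz (meanMatrix m A Q) := by
  constructor
  · rintro ⟨C, β, hC, hβ, h⟩
    -- The test vectors are the initial moments. A form vanishing on them vanishes on every mode's
    -- block by `eq_zero_of_powerVec`.
    refine isHurwitz_of_tendsto {u | ∃ (r₀ : Fin N) (v : Fin n → ℝ),
      u = fun a => if a.1 = r₀ then powerVec m v a.2 else 0} (fun w hw => ?_) ?_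
    · have h1 : ∀ r₀ : Fin N, (fun σ => w (r₀, σ)) = 0 := fun r₀ =>
        eq_zero_of_powerVec _ fun v => by
          have := hw _ ⟨r₀, v, rfl⟩
          simp only [dotProduct, Fintype.sum_prod_type, mul_ite, mul_zero] at this
          rw [Finset.sum_comm] at this
          simpa [dotProduct] using this
      exact funext fun a => congrFun (h1 a.1) a.2
    · rintro _ ⟨r₀, v, rfl⟩
      refine tendsto_exp_mulVec_of_tendsto (hr r₀) (hr0 r₀) m (hx r₀ v) ?_
      have hexp : Tendsto (fun t : ℝ => C * Real.exp (-β * t) * ‖WithLp.toLp 2 v‖ ^ m) atTop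
          (𝓝 (C * 0 * ‖WithLp.toLp 2 v‖ ^ m)) := by
        refine ((Real.tendsto_exp_atBot.comp ?_).const_mul C).mul_const _
        exact tendsto_id.const_mul_atTop_of_neg (neg_lt_zero.2 hβ)
      rw [mul_zero, zero_mul] at hexp
      refine squeeze_zero' (Eventually.of_forall fun t => integral_nonneg fun ω => by positivity) ?_
        hexp
      filter_upwards [eventually_ge_atTop 0] with t ht using (h r₀ v t ht).2
  · exact exponentiallyMeanStable_of_isHurwitz hA hr hr0 m hx
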